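/- Call $\sigma:\mathbb{R}\to\mathbb{R}$ a saturation function if it is odd, globally Lipschitz and non-decreasing, $\xi\sigma(\xi)>0$ for every $\xi\neq 0$, the limits $\sigma_\infty=\lim_{\xi\to+\infty}\sigma(\xi)$ and $\sigma'(0)=\lim_{\xi\to 0}\sigma(\xi)/\xi$ exist and are positive (and finite), and $\sigma'$ is non-increasing on the set of points of $[0,\infty)$ where it exists. Let $A_0=\begin{pmatrix}0&-1\\1&0\end{pmatrix}$, let $e_2=(0,1)^T\in\mathbb{R}^2$, and for $\varepsilon>0$ and $K\in\mathbb{R}^4$ consider the closed-loop system on $\mathbb{R}^4=\mathbb{R}^2\times\mathbb{R}^2$ $$(S_\varepsilon)\qquad \dot x_1=\frac{2\pi}{\varepsilon}A_0x_1+x_2,\qquad \dot x_2=\frac{2\pi}{\varepsilon}A_0x_2-e_2\,\sigma(K^Tx),\qquad x=(x_1,x_2).$$ **Proposition.** For every saturation function $\sigma$ there is $\varepsilon_0>0$ such that, for every $\varepsilon\in(0,\varepsilon_0)$, the system $(S_\varepsilon)$ with the feedback $K=K_\varepsilon=\begin{pmatrix}e_2\\e_2\end{pmatrix}$, that is, with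 $K^Tx=e_2^T(x_1+x_2)$, is globally asymptotically stable with respect to the origin: every initial condition has a unique trajectory on $[0,\infty)$; for every $\eta>0$ there is $\delta>0$ such that every trajectory with $\|x(0)\|<\delta$ satisfies $\|x(t)\|<\eta$ for all $t\ge 0$; and every trajectory converges to $0$ as $t\to+\infty$. In particular, for every $\varepsilon\in(0,\varepsilon_0)$ there is a stabilizing linear feedback for $(S_\varepsilon)$. -/

import Mathlib

open Filter Topology

noncomputable section

/-- A scalar saturation function. A globally Lipschitz function need not be differentiable
everywhere (the standard saturation `ξ / max 1 |ξ|` is not), so the requirement that `σ'` is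
non-increasing on `[0, ∞)` is imposed on the set of points where `σ'` exists. -/
structure IsSaturation (σ : ℝ → ℝ) : Prop where
  odd : Function.Odd σ
  lipschitz : ∃ L : NNReal, LipschitzWith L σ
  sign : ∀ ξ : ℝ, ξ ≠ 0 → 0 < σ ξ * ξ
  limit_atTop : ∃ σinf : ℝ, 0 < σinf ∧ Tendsto σ atTop (𝓝 σinf)
  slope_zero : ∃ m : ℝ, 0 < m ∧ Tendsto (fun ξ => σ ξ / ξ) (𝓝[≠] 0) (𝓝 m)
  mono : Monotone σ
  deriv_antitone : AntitoneOn (deriv σ) {ξ : ℝ | 0 ≤ ξ ∧ DifferentiableAt ℝ σ ξ}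

/-- `x` is a forward trajectory of the autonomous system `ẋ = F x`, defined for all `t ≥ 0`
(with a one-sided derivative at `t = 0`). -/
def IsTrajectory {E : Type*} [NormedAddCommGroup E] [NormedSpace ℝ E] (F : E → E) (x : ℝ → E) :
    Prop :=
  IsIntegralCurveOn x (fun _ => F) (Set.Ici 0)

/-- Global asymptotic stability of `ẋ = F x` with respect to the origin: every initial condition
has a unique trajectory on `[0, ∞)`, the origin is Lyapunov stable, and every trajectory
converges to the origin. -/
structure IsGAS {E : Type*} [NormedAddCommGroup E] [NormedSpace ℝ E] (F : E → E) : Prop where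
  exists_trajectory : ∀ x₀ : E, ∃ x : ℝ → E, IsTrajectory F x ∧ x 0 = x₀
  unique_trajectory : ∀ x x' : ℝ → E, IsTrajectory F x → IsTrajectory F x' → x 0 = x' 0 →
    ∀ t : ℝ, 0 ≤ t → x t = x' t
  stable : ∀ η : ℝ, 0 < η → ∃ δ : ℝ, 0 < δ ∧ ∀ x : ℝ → E, IsTrajectory F x → ‖x 0‖ < δ →
    ∀ t : ℝ, 0 ≤ t → ‖x t‖ < η
  attractive : ∀ x : ℝ → E, IsTrajectory F x → Tendsto x atTop (𝓝 0)

/-- The Euclidean plane. The state space `ℝ⁴` is `Plane × Plane`, with `x = (x₁, x₂)`. Its norm is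
equivalent to the Euclidean one, and global asymptotic stability depends on the topology only. -/
abbrev Plane : Type := EuclideanSpace ℝ (Fin 2)

/-- The second vector of the canonical basis of the plane. -/
def e₂ : Plane := EuclideanSpace.single 1 1

/-- The rotation matrix of angle `π / 2`. -/
def A₀ : Matrix (Fin 2) (Fin 2) ℝ := !![0, -1; 1, 0]

/-- The vector field on `ℝ⁴` of the rescaled closed-loop system with linear feedback `K`:
`ẋ₁ = (2π/ε) A₀ x₁ + x₂`, `ẋ₂ = (2π/ε) A₀ x₂ - σ(Kᵀ x) e₂`. -/
def rescaledClosedLoop (σ : ℝ → ℝ) (ε : ℝ) (K x : Plane × Plane) : Plane × Plane :=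
  ((2 * Real.pi / ε) • Matrix.toEuclideanLin A₀ x.1 + x.2,
   (2 * Real.pi / ε) • Matrix.toEuclideanLin A₀ x.2
      - σ (inner ℝ K.1 x.1 + inner ℝ K.2 x.2) • e₂)

end

/-! Identify the plane with ℂ and use the frame rotating at speed ω = 2π/ε, with period T = ε.
Writing E for `carrier`, ζ for x₁ + x₂ and η for x₂, the system becomes ζ' = η - i c, η' = -i c,
where c = conj(E) u and u = σ(Im(E ζ)).

The Lyapunov quantity is `slowEnergy`, T/2 |η|² plus the integral over the last period of S(Im(E
ζ)), where S is the primitive of σ. Over one period ζ moves by about T η - i ∫ c. Convexity of S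
makes the T η part cancel the kinetic power, and the ∫ c part yields a damping -|C|², with C the
mean of c over a period (`inputMean`). Co-coercivity of σ (`satPotential_sub_le`) adds -D²/(2lT),
where D (`inputChange`) is the L¹ change of u from one period to the next. With A the L¹ mass of u
(`inputMass`), the error is at most A(D + T(A + D)); this is `slowEnergy_add_period_le`.

To absorb the error, A must be controlled by |C| and D. Since η may be large, ζ need not be nearly
constant over a period. Yet the outputs at s and s - T lie, up to a small error, on opposite sides
of the sinusoid with ζ frozen, so monotonicity of σ bounds the distance from u to the response to
that sinusoid by the change of u (`abs_rotInput_sub_le`). The first harmonic of this response is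
comparable to T σ(|ζ|), because σ(r/2) ≥ κ σ(r) (`mul_le_norm_inputMean`). Hence κA/16 ≤ |C| + 2D,
and for small T the energy loses at least κ²A²/1024 + D² per period
(`slowEnergy_add_period_le_of_small`).

The energy is nonnegative, so A and D tend to 0 along multiples of T. This forces σ(|ζ|), then ζ,
then η to 0 along these times. A small energy forces a small state by the same inequality, which
gives stability; stability turns convergence along a sequence into convergence. -/

open scoped ComplexConjugate

/-! ### Scalar saturation functions -/

namespace IsSaturation

theorem map_zero {σ : ℝ → ℝ} (hσ : IsSaturation σ) : σ 0 = 0 := by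
  have h := hσ.odd 0
  rw [neg_zero] at h
  linarith

theorem pos {σ : ℝ → ℝ} (hσ : IsSaturation σ) {r : ℝ} (hr : 0 < r) : 0 < σ r :=
  pos_of_mul_pos_left (hσ.sign r hr.ne') hr.le

theorem nonneg {σ : ℝ → ℝ} (hσ : IsSaturation σ) {r : ℝ} (hr : 0 ≤ r) : 0 ≤ σ r := by
  simpa [hσ.map_zero] using hσ.mono hr

theorem abs_map {σ : ℝ → ℝ} (hσ : IsSaturation σ) (x : ℝ) : |σ x| = σ |x| := by
  rcases le_total 0 x with h | h
  · rw [abs_of_nonneg h, abs_of_nonneg (hσ.nonneg h)]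
  · have h1 := hσ.nonneg (neg_nonneg.2 h)
    rw [abs_of_nonpos h, ← abs_neg, ← hσ.odd x, abs_of_nonneg h1]

theorem exists_abs_sub_le {σ : ℝ → ℝ} (hσ : IsSaturation σ) :
    ∃ l : ℝ, 0 < l ∧ ∀ a b, |σ a - σ b| ≤ l * |a - b| := by
  obtain ⟨L, hL⟩ := hσ.lipschitz
  refine ⟨L + 1, by positivity, fun a b => ?_⟩
  have h := hL.dist_le_mul a b
  rw [Real.dist_eq, Real.dist_eq] at h
  nlinarith [abs_nonneg (a - b)]

theorem continuous {σ : ℝ → ℝ} (hσ : IsSaturation σ) : Continuous σ :=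
  hσ.lipschitz.choose_spec.continuous

/-- Halving the argument of a saturation function divides its value by a bounded factor. -/
theorem exists_mul_le_half {σ : ℝ → ℝ} (hσ : IsSaturation σ) :
    ∃ κ : ℝ, 0 < κ ∧ κ ≤ 1 ∧ ∀ r, 0 ≤ r → κ * σ r ≤ σ (r / 2) := by
  obtain ⟨c, hc, hlim⟩ := hσ.limit_atTop
  obtain ⟨m, hm, hslope⟩ := hσ.slope_zero
  have hle : ∀ r, σ r ≤ c := hσ.mono.ge_of_tendsto hlim
  have hev : ∀ᶠ ξ in 𝓝[≠] (0 : ℝ), σ ξ / ξ ∈ Set.Ioo (m / 2) (2 * m) :=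
    hslope.eventually (Ioo_mem_nhds (by linarith) (by linarith))
  rw [eventually_nhdsWithin_iff, Metric.eventually_nhds_iff] at hev
  obtain ⟨δ, hδ, hev⟩ := hev
  have hlin : ∀ r, 0 < r → r < δ → m / 2 * r < σ r ∧ σ r < 2 * m * r := by
    intro r hr hrδ
    have h := hev (y := r) (by simpa [abs_of_pos hr] using hrδ) hr.ne'
    exact ⟨(lt_div_iff₀ hr).1 h.1, (div_lt_iff₀ hr).1 h.2⟩
  have hδ2 : 0 < σ (δ / 2) := hσ.pos (by linarith)
  -- Near 0, σ lies between slopes m/2 and 2m, and halving the argument costs another factor 2: this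
  -- gives 1/8. Beyond δ, σ(r/2) is at least σ(δ/2) while σ(r) is at most the limit c.
  refine ⟨min (1 / 8) (σ (δ / 2) / c), by positivity,
    (min_le_left _ _).trans (by norm_num), fun r hr => ?_⟩
  have hσr := hσ.nonneg hr
  rcases hr.eq_or_lt with rfl | hr
  · simp [hσ.map_zero]
  rcases lt_or_ge r δ with h | h
  · have h1 := (hlin r hr h).2
    have h2 := (hlin (r / 2) (by linarith) (by linarith)).1
    calc min (1 / 8) (σ (δ / 2) / c) * σ r ≤ 1 / 8 * σ r := by gcongr; exact min_le_left _ _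
      _ ≤ σ (r / 2) := by linarith
  · calc min (1 / 8) (σ (δ / 2) / c) * σ r ≤ σ (δ / 2) / c * c := by
          gcongr
          · exact min_le_right _ _
          · exact hle r
      _ = σ (δ / 2) := by field_simp
      _ ≤ σ (r / 2) := hσ.mono (by linarith)

end IsSaturation

/-! ### The primitive of the saturation and its co-coercivity -/

/-- The primitive of `σ` vanishing at the origin. -/
noncomputable def satPotential (σ : ℝ → ℝ) (x : ℝ) : ℝ := ∫ s in (0 : ℝ)..x, σ s

theorem satPotential_neg {σ : ℝ → ℝ} (hodd : Function.Odd σ) (x : ℝ) :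
    satPotential σ (-x) = satPotential σ x := by
  have h := intervalIntegral.integral_comp_neg (a := 0) (b := x) (fun s => σ s)
  simp only [hodd _, neg_zero, intervalIntegral.integral_neg] at h
  rw [satPotential, satPotential, intervalIntegral.integral_symm, ← h, neg_neg]

theorem satPotential_sub {σ : ℝ → ℝ} (hc : Continuous σ) (a b : ℝ) :
    satPotential σ a - satPotential σ b = ∫ s in b..a, σ s :=
  intervalIntegral.integral_interval_sub_left (hc.intervalIntegrable _ _)
    (hc.intervalIntegrable _ _)

/-- On [b, a] the graph of σ stays below both the line of slope l through (b, σ b) and the level σ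
a. The two meet at b + d/l, and the triangle cut off the rectangle has area d²/(2l). -/
theorem satPotential_sub_le_of_le {σ : ℝ → ℝ} (hmono : Monotone σ) {l : ℝ} (hl : 0 < l)
    (hlip : ∀ a b, |σ a - σ b| ≤ l * |a - b|) (hc : Continuous σ) {a b : ℝ} (hab : b ≤ a) :
    satPotential σ a - satPotential σ b ≤ σ a * (a - b) - (σ a - σ b) ^ 2 / (2 * l) := by
  set d := σ a - σ b with hd
  have hd0 : 0 ≤ d := sub_nonneg.2 (hmono hab)
  have hda : b + d / l ≤ a := by
    have h := hlip a b
    rw [abs_of_nonneg hd0, abs_of_nonneg (sub_nonneg.2 hab)] at h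
    have : d / l ≤ a - b := (div_le_iff₀ hl).2 (by linarith)
    linarith
  have hbd : b ≤ b + d / l := by
    have : 0 ≤ d / l := by positivity
    linarith
  have hi : ∀ x y, IntervalIntegrable σ MeasureTheory.volume x y :=
    fun x y => hc.intervalIntegrable x y
  have h1 : ∫ s in b..(b + d / l), σ s ≤ ∫ s in b..(b + d / l), (σ b + l * (s - b)) := by
    refine intervalIntegral.integral_mono_on hbd (hi _ _)
      ((by fun_prop : Continuous fun s => σ b + l * (s - b)).intervalIntegrable _ _) ?_
    intro s hs
    have h := (le_abs_self _).trans (hlip s b)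
    rw [abs_of_nonneg (sub_nonneg.2 hs.1)] at h
    linarith
  have h2 : ∫ s in (b + d / l)..a, σ s ≤ ∫ s in (b + d / l)..a, σ a :=
    intervalIntegral.integral_mono_on hda (hi _ _) intervalIntegrable_const
      fun s hs => hmono hs.2
  have h3 : ∫ s in b..(b + d / l), (σ b + l * (s - b)) = σ b * (d / l) + l * (d / l) ^ 2 / 2 := by
    rw [intervalIntegral.integral_add intervalIntegrable_const
      ((by fun_prop : Continuous fun s => l * (s - b)).intervalIntegrable _ _),
      intervalIntegral.integral_const_mul,
      intervalIntegral.integral_comp_sub_right (fun s => s)]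
    simp
    ring
  rw [intervalIntegral.integral_const, smul_eq_mul] at h2
  rw [satPotential_sub hc, ← intervalIntegral.integral_add_adjacent_intervals
    (hi b (b + d / l)) (hi _ a)]
  have h4 : σ b = σ a - d := by rw [hd]; ring
  rw [h3, h4] at h1
  have h5 : l * (d / l) ^ 2 / 2 = d * (d / l) / 2 := by field_simp
  have h6 : d ^ 2 / (2 * l) = d * (d / l) / 2 := by field_simp
  rw [h6]
  rw [h5] at h1
  linarith

/-- Co-coercivity of the derivative of the convex function `satPotential σ`. -/
theorem satPotential_sub_le {σ : ℝ → ℝ} (hodd : Function.Odd σ) (hmono : Monotone σ) {l : ℝ}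
    (hl : 0 < l) (hlip : ∀ a b, |σ a - σ b| ≤ l * |a - b|) (hc : Continuous σ) (a b : ℝ) :
    satPotential σ a - satPotential σ b ≤ σ a * (a - b) - (σ a - σ b) ^ 2 / (2 * l) := by
  rcases le_total b a with h | h
  · exact satPotential_sub_le_of_le hmono hl hlip hc h
  -- Reflection through the origin exchanges the two orders, since σ is odd and its primitive even.
  · have := satPotential_sub_le_of_le hmono hl hlip hc (neg_le_neg h)
    rw [satPotential_neg hodd, satPotential_neg hodd, hodd, hodd] at this
    rw [show (-σ a - -σ b) ^ 2 = (σ a - σ b) ^ 2 by ring] at this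
    linarith

theorem continuous_satPotential {σ : ℝ → ℝ} (hc : Continuous σ) : Continuous (satPotential σ) :=
  intervalIntegral.continuous_primitive (fun _ _ => hc.intervalIntegrable _ _) 0

theorem satPotential_nonneg {σ : ℝ → ℝ} (hodd : Function.Odd σ) (hmono : Monotone σ) {l : ℝ}
    (hl : 0 < l) (hlip : ∀ a b, |σ a - σ b| ≤ l * |a - b|) (hc : Continuous σ) (x : ℝ) :
    0 ≤ satPotential σ x := by
  have h0 : σ 0 = 0 := by
    have h := hodd 0
    rw [neg_zero] at h
    linarith
  have h := satPotential_sub_le hodd hmono hl hlip hc 0 x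
  have h1 : 0 ≤ (σ 0 - σ x) ^ 2 / (2 * l) := by positivity
  have h2 : satPotential σ 0 = 0 := by simp [satPotential]
  rw [h2, h0, zero_mul] at h
  rw [h0] at h1
  linarith

theorem satPotential_le_mul_sq {σ : ℝ → ℝ} (hodd : Function.Odd σ) (hmono : Monotone σ) {l : ℝ}
    (hl : 0 < l) (hlip : ∀ a b, |σ a - σ b| ≤ l * |a - b|) (hc : Continuous σ) (x : ℝ) :
    satPotential σ x ≤ l * x ^ 2 := by
  have h0 : σ 0 = 0 := by
    have h := hodd 0
    rw [neg_zero] at h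
    linarith
  have h := satPotential_sub_le hodd hmono hl hlip hc x 0
  have h1 : 0 ≤ (σ x - σ 0) ^ 2 / (2 * l) := by positivity
  have h2 : satPotential σ 0 = 0 := by simp [satPotential]
  have h3 := hlip x 0
  simp only [h0, h2, sub_zero] at h h1 h3
  have h4 : σ x * x ≤ l * x ^ 2 := by
    calc σ x * x ≤ |σ x * x| := le_abs_self _
      _ = |σ x| * |x| := abs_mul _ _
      _ ≤ l * |x| * |x| := by gcongr
      _ = l * x ^ 2 := by rw [mul_assoc, ← sq, sq_abs]
  linarith

/-! ### Lipschitz vector fields -/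

theorem exists_integralCurve_Icc_of_lipschitz {E : Type*} [NormedAddCommGroup E]
    [NormedSpace ℝ E] [CompleteSpace E] {F : E → E} {K : NNReal} (hF : LipschitzWith K F)
    {h : ℝ} (hh : 0 ≤ h) (hK : K * h ≤ 1 / 2) (x₀ : E) :
    ∃ x : ℝ → E, x 0 = x₀ ∧
      ∀ t ∈ Set.Icc 0 h, HasDerivWithinAt x (F (x t)) (Set.Icc 0 h) t := by
  -- With Kh ≤ 1/2, this radius satisfies (‖F x₀‖ + K a) h ≤ a, so the Picard iteration stays in the
  -- ball. The step h does not depend on x₀, and local solutions can be concatenated forever.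
  let a : NNReal := ⟨2 * h * ‖F x₀‖, by positivity⟩
  let M : NNReal := ‖F x₀‖₊ + K * a
  have hP : IsPicardLindelof (fun _ => F) (⟨0, le_rfl, hh⟩ : Set.Icc 0 h) x₀ a 0 M K := by
    refine IsPicardLindelof.of_time_independent ?_ hF.lipschitzOnWith ?_
    · intro x hx
      have h1 := hF.dist_le_mul x x₀
      have h2 : ‖F x‖ ≤ ‖F x₀‖ + ‖F x - F x₀‖ := norm_le_insert' _ _
      rw [dist_eq_norm] at h1
      calc ‖F x‖ ≤ ‖F x₀‖ + K * dist x x₀ := h2.trans (by gcongr)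
        _ ≤ ‖F x₀‖ + K * a := by gcongr; exact Metric.mem_closedBall.1 hx
        _ = M := by simp [M]
    · simp only [sub_zero, sub_self, max_eq_left hh, NNReal.coe_zero]
      have ha : (a : ℝ) = 2 * h * ‖F x₀‖ := rfl
      have hM : (M : ℝ) = ‖F x₀‖ + K * a := by simp [M]
      rw [hM, ha]
      nlinarith [mul_nonneg hh (norm_nonneg (F x₀))]
  exact hP.exists_eq_forall_mem_Icc_hasDerivWithinAt₀

/-- A Lipschitz vector field on a Banach space has a forward trajectory from every point. -/
theorem exists_isTrajectory_of_lipschitz {E : Type*} [NormedAddCommGroup E]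
    [NormedSpace ℝ E] [CompleteSpace E] {F : E → E} {K : NNReal} (hF : LipschitzWith K F)
    (x₀ : E) : ∃ x : ℝ → E, IsTrajectory F x ∧ x 0 = x₀ := by
  obtain ⟨h, hh, hK⟩ : ∃ h : ℝ, 0 < h ∧ K * h ≤ 1 / 2 := by
    refine ⟨1 / (2 * (K + 1)), by positivity, ?_⟩
    rw [mul_one_div, div_le_div_iff₀ (by positivity) (by norm_num)]
    linarith
  choose α hα0 hα using fun p => exists_integralCurve_Icc_of_lipschitz hF hh.le hK p
  let p : ℕ → E := fun n => Nat.rec x₀ (fun _ q => α q h) n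
  let x : ℝ → E := fun t => α (p ⌊t / h⌋₊) (t - ⌊t / h⌋₊ * h)
  have hx : ∀ n : ℕ, ∀ t ∈ Set.Icc (n * h) ((n + 1) * h), x t = α (p n) (t - n * h) := by
    intro n t ht
    -- At the right endpoint the floor already selects the next piece, which starts where this one
    -- ends.
    rcases ht.2.eq_or_lt with h1 | h1
    · have hfl : ⌊t / h⌋₊ = n + 1 := by
        rw [h1, mul_div_cancel_right₀ _ hh.ne']
        exact_mod_cast Nat.floor_natCast (R := ℝ) (n + 1)
      have h2 : t - n * h = h := by rw [h1]; ring
      simp only [x, hfl, h2]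
      rw [h1]
      push_cast
      rw [sub_self, hα0]
    · have hfl : ⌊t / h⌋₊ = n := by
        have h0 : 0 ≤ t := le_trans (by positivity) ht.1
        rw [Nat.floor_eq_iff (by positivity)]
        exact ⟨(le_div_iff₀ hh).2 ht.1, (div_lt_iff₀ hh).2 h1⟩
      simp only [x, hfl]
  have hd : ∀ n : ℕ, ∀ t ∈ Set.Icc (n * h) ((n + 1) * h),
      HasDerivWithinAt x (F (x t)) (Set.Icc (n * h) ((n + 1) * h)) t := by
    intro n t ht
    have hmaps : Set.MapsTo (fun s => s - n * h) (Set.Icc (n * h) ((n + 1) * h))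
        (Set.Icc 0 h) := fun s hs => ⟨by linarith [hs.1], by linarith [hs.2]⟩
    have h1 := (hα (p n) (t - n * h) (hmaps ht)).scomp t
      (((hasDerivAt_id t).sub_const (n * h)).hasDerivWithinAt) hmaps
    rw [one_smul, ← hx n t ht] at h1
    exact h1.congr (hx n) (hx n t ht)
  refine ⟨x, fun t ht => ?_, ?_⟩
  · have ht : 0 ≤ t := ht
    set n := ⌊t / h⌋₊ with hn
    have hn1 : n * h ≤ t := (le_div_iff₀ hh).1 (Nat.floor_le (by positivity))
    have hn2 : t < (n + 1) * h := (div_lt_iff₀ hh).1 (Nat.lt_floor_add_one _)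
    have hr : HasDerivWithinAt x (F (x t)) (Set.Icc t ((n + 1) * h)) t :=
      (hd n t ⟨hn1, hn2.le⟩).mono (Set.Icc_subset_Icc_left hn1)
    have hr' : HasDerivWithinAt x (F (x t)) (Set.Ici t) t :=
      hr.mono_of_mem_nhdsWithin (Icc_mem_nhdsGE hn2)
    -- At a junction the left derivative comes from the preceding piece; at time 0 the left interval
    -- is a single point.
    have hl : HasDerivWithinAt x (F (x t)) (Set.Icc 0 t) t := by
      rcases hn1.eq_or_lt with h1 | h1
      · rcases n with _ | n
        · have : t = 0 := by rw [← h1]; simp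
          rw [this, Set.Icc_self]
          exact HasFDerivWithinAt.of_finite (Set.finite_singleton _)
        · push_cast at h1
          have h3 : n * h < t := by linarith
          have h2 := hd n t ⟨h3.le, h1.ge⟩
          rw [h1] at h2
          exact h2.mono_of_mem_nhdsWithin
            (nhdsWithin_mono _ Set.Icc_subset_Iic_self (Icc_mem_nhdsLE h3))
      · have h2 := (hd n t ⟨hn1, hn2.le⟩).mono (Set.Icc_subset_Icc_right hn2.le)
        exact h2.mono_of_mem_nhdsWithin (nhdsWithin_mono _ Set.Icc_subset_Iic_self
          (Icc_mem_nhdsLE h1))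
    have hu := hl.union hr'
    rwa [Set.Icc_union_Ici_eq_Ici ht] at hu
  · have h1 := hx 0 0 ⟨by simp, by simpa using hh.le⟩
    rw [h1]
    simp [hα0, p]

theorem IsTrajectory.hasDerivWithinAt_Ici {E : Type*} [NormedAddCommGroup E] [NormedSpace ℝ E]
    {F : E → E} {x : ℝ → E} (hx : IsTrajectory F x) {t : ℝ} (ht : 0 ≤ t) :
    HasDerivWithinAt x (F (x t)) (Set.Ici t) t :=
  (hx t ht).mono (Set.Ici_subset_Ici.2 ht)

theorem IsTrajectory.continuousOn_Icc {E : Type*} [NormedAddCommGroup E] [NormedSpace ℝ E]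
    {F : E → E} {x : ℝ → E} (hx : IsTrajectory F x) (b : ℝ) : ContinuousOn x (Set.Icc 0 b) :=
  (IsIntegralCurveOn.continuousOn hx).mono Set.Icc_subset_Ici_self

theorem IsTrajectory.comp_add {E : Type*} [NormedAddCommGroup E] [NormedSpace ℝ E]
    {F : E → E} {x : ℝ → E} (hx : IsTrajectory F x) {c : ℝ} (hc : 0 ≤ c) :
    IsTrajectory F (fun t => x (t + c)) := by
  intro t ht
  have ht : 0 ≤ t := ht
  have h := (hx (t + c) (add_nonneg ht hc)).scomp t
    (((hasDerivAt_id t).add_const c).hasDerivWithinAt (s := Set.Ici 0))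
    (fun s hs => add_nonneg hs hc)
  rwa [one_smul] at h

theorem IsTrajectory.eq_of_lipschitz {E : Type*} [NormedAddCommGroup E] [NormedSpace ℝ E]
    {F : E → E} {K : NNReal} (hF : LipschitzWith K F) {x x' : ℝ → E} (hx : IsTrajectory F x)
    (hx' : IsTrajectory F x') (h0 : x 0 = x' 0) {t : ℝ} (ht : 0 ≤ t) : x t = x' t :=
  ODE_solution_unique (v := fun _ => F) (fun _ => hF) (hx.continuousOn_Icc t)
    (fun _ hs => hx.hasDerivWithinAt_Ici hs.1) (hx'.continuousOn_Icc t)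
    (fun _ hs => hx'.hasDerivWithinAt_Ici hs.1) h0 ⟨ht, le_rfl⟩

/-- Grönwall's inequality against the zero trajectory. It covers the initial time interval, on which
the delayed energy gives no estimate. -/
theorem IsTrajectory.norm_le_of_lipschitz {E : Type*} [NormedAddCommGroup E] [NormedSpace ℝ E]
    {F : E → E} {K : NNReal} (hF : LipschitzWith K F) (hF0 : F 0 = 0) {x : ℝ → E}
    (hx : IsTrajectory F x) {t : ℝ} (ht : 0 ≤ t) : ‖x t‖ ≤ ‖x 0‖ * Real.exp (K * t) := by
  have h := dist_le_of_trajectories_ODE (v := fun _ => F) (g := fun _ => 0) (δ := ‖x 0‖)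
    (fun _ => hF) (hx.continuousOn_Icc t)
    (fun _ hs => hx.hasDerivWithinAt_Ici hs.1) continuousOn_const
    (fun s _ => by simpa [hF0] using hasDerivWithinAt_const s (Set.Ici s) (0 : E))
    (by simp) t ⟨ht, le_rfl⟩
  simpa using h

/-! ### The system in the rotating frame -/

/-- The oscillation `exp (i ω t)`. -/
noncomputable def carrier (ω t : ℝ) : ℂ := Complex.exp ((ω * t : ℝ) * Complex.I)

/-- The measured output, for a state given in the rotating frame. -/
noncomputable def rotOutput (ω : ℝ) (ζ : ℝ → ℂ) (t : ℝ) : ℝ := (carrier ω t * ζ t).im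

/-- The saturated input. -/
noncomputable def rotInput (σ : ℝ → ℝ) (ω : ℝ) (ζ : ℝ → ℂ) (t : ℝ) : ℝ := σ (rotOutput ω ζ t)

/-- The saturated input, as seen in the rotating frame. -/
noncomputable def demodInput (σ : ℝ → ℝ) (ω : ℝ) (ζ : ℝ → ℂ) (t : ℝ) : ℂ :=
  conj (carrier ω t) * rotInput σ ω ζ t

/-- The closed-loop system in the rotating frame: `ζ` stands for `x₁ + x₂` and `η` for `x₂`. -/
structure SlowDynamics (σ : ℝ → ℝ) (ω : ℝ) (ζ η : ℝ → ℂ) : Prop where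
  continuous_fst : Continuous ζ
  continuous_snd : Continuous η
  deriv_fst : ∀ t, 0 < t → HasDerivAt ζ (η t - Complex.I * demodInput σ ω ζ t) t
  deriv_snd : ∀ t, 0 < t → HasDerivAt η (-(Complex.I * demodInput σ ω ζ t)) t

theorem norm_carrier (ω t : ℝ) : ‖carrier ω t‖ = 1 := Complex.norm_exp_ofReal_mul_I _

theorem continuous_carrier (ω : ℝ) : Continuous (carrier ω) := by
  unfold carrier
  fun_prop

theorem carrier_sub_period {ω T : ℝ} (hT : ω * T = 2 * Real.pi) (t : ℝ) :
    carrier ω (t - T) = carrier ω t := by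
  have h : (((ω * (t - T) : ℝ) : ℂ) * Complex.I)
      = ((ω * t : ℝ) : ℂ) * Complex.I - 2 * Real.pi * Complex.I := by
    rw [mul_sub, hT]
    push_cast
    ring
  rw [carrier, h, Complex.exp_periodic.sub_eq, carrier]

theorem carrier_mul_conj (ω t : ℝ) : carrier ω t * conj (carrier ω t) = 1 := by
  rw [Complex.mul_conj, Complex.normSq_eq_norm_sq, norm_carrier]
  simp

theorem norm_demodInput (σ : ℝ → ℝ) (ω : ℝ) (ζ : ℝ → ℂ) (t : ℝ) :
    ‖demodInput σ ω ζ t‖ = |rotInput σ ω ζ t| := by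
  rw [demodInput, norm_mul, RCLike.norm_conj, norm_carrier, one_mul, Complex.norm_real,
    Real.norm_eq_abs]

theorem demodInput_sub_period {σ : ℝ → ℝ} {ω T : ℝ} (hT : ω * T = 2 * Real.pi) (ζ : ℝ → ℂ)
    (t : ℝ) : ‖demodInput σ ω ζ t - demodInput σ ω ζ (t - T)‖
      = |rotInput σ ω ζ t - rotInput σ ω ζ (t - T)| := by
  rw [demodInput, demodInput, carrier_sub_period hT, ← mul_sub, norm_mul, RCLike.norm_conj,
    norm_carrier, one_mul, ← Complex.ofReal_sub, Complex.norm_real, Real.norm_eq_abs]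

theorem rotOutput_sub_period {ω T : ℝ} (hT : ω * T = 2 * Real.pi) (ζ : ℝ → ℂ) (t : ℝ) :
    rotOutput ω ζ (t - T) = (carrier ω t * ζ (t - T)).im := by
  rw [rotOutput, carrier_sub_period hT]

namespace SlowDynamics

variable {σ : ℝ → ℝ} {ω T l : ℝ} {ζ η : ℝ → ℂ}

theorem continuous_rotOutput (h : SlowDynamics σ ω ζ η) : Continuous (rotOutput ω ζ) :=
  Complex.continuous_im.comp ((continuous_carrier ω).mul h.continuous_fst)

theorem continuous_rotInput (h : SlowDynamics σ ω ζ η) (hσ : Continuous σ) :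
    Continuous (rotInput σ ω ζ) := hσ.comp h.continuous_rotOutput

theorem continuous_demodInput (h : SlowDynamics σ ω ζ η) (hσ : Continuous σ) :
    Continuous (demodInput σ ω ζ) :=
  (Complex.continuous_conj.comp (continuous_carrier ω)).mul
    (Complex.continuous_ofReal.comp (h.continuous_rotInput hσ))

theorem snd_sub_eq (h : SlowDynamics σ ω ζ η) (hσ : Continuous σ) {a b : ℝ} (ha : 0 ≤ a)
    (hab : a ≤ b) : η b - η a = -(Complex.I * ∫ s in a..b, demodInput σ ω ζ s) := by
  rw [← intervalIntegral.integral_const_mul, ← intervalIntegral.integral_neg]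
  refine (intervalIntegral.integral_eq_sub_of_hasDerivAt_of_le hab h.continuous_snd.continuousOn
    (fun t ht => h.deriv_snd t (ha.trans_lt ht.1)) ?_).symm
  have := h.continuous_demodInput hσ
  exact (by fun_prop : Continuous fun t => -(Complex.I * demodInput σ ω ζ t)).intervalIntegrable _ _

theorem fst_sub_eq (h : SlowDynamics σ ω ζ η) (hσ : Continuous σ) {a b : ℝ} (ha : 0 ≤ a)
    (hab : a ≤ b) :
    ζ b - ζ a = (∫ s in a..b, η s) - Complex.I * ∫ s in a..b, demodInput σ ω ζ s := by
  have hd := h.continuous_demodInput hσ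
  rw [← intervalIntegral.integral_const_mul, ← intervalIntegral.integral_sub
    (h.continuous_snd.intervalIntegrable _ _)
    ((by fun_prop : Continuous fun t => Complex.I * demodInput σ ω ζ t).intervalIntegrable _ _)]
  refine (intervalIntegral.integral_eq_sub_of_hasDerivAt_of_le hab h.continuous_fst.continuousOn
    (fun t ht => h.deriv_fst t (ha.trans_lt ht.1)) ?_).symm
  have := h.continuous_snd
  exact (by fun_prop :
    Continuous fun t => η t - Complex.I * demodInput σ ω ζ t).intervalIntegrable _ _

theorem norm_integral_demodInput_le (σ : ℝ → ℝ) (ω : ℝ) (ζ : ℝ → ℂ) {a b : ℝ} (hab : a ≤ b) :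
    ‖∫ s in a..b, demodInput σ ω ζ s‖ ≤ ∫ s in a..b, |rotInput σ ω ζ s| :=
  (intervalIntegral.norm_integral_le_integral_norm hab).trans_eq
    (by simp only [norm_demodInput])

theorem norm_snd_sub_le (h : SlowDynamics σ ω ζ η) (hσ : Continuous σ) {a b : ℝ} (ha : 0 ≤ a)
    (hab : a ≤ b) : ‖η b - η a‖ ≤ ∫ s in a..b, |rotInput σ ω ζ s| := by
  rw [h.snd_sub_eq hσ ha hab, norm_neg, norm_mul, Complex.norm_I, one_mul]
  exact norm_integral_demodInput_le σ ω ζ hab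

theorem norm_integral_snd_sub_le (h : SlowDynamics σ ω ζ η) {a b M : ℝ} (hab : a ≤ b) (v : ℂ)
    (hM : ∀ s ∈ Set.Icc a b, ‖η s - v‖ ≤ M) :
    ‖(∫ s in a..b, η s) - (b - a : ℝ) * v‖ ≤ M * (b - a) := by
  have h1 : (∫ s in a..b, η s) - (b - a : ℝ) * v = ∫ s in a..b, (η s - v) := by
    rw [intervalIntegral.integral_sub (h.continuous_snd.intervalIntegrable _ _)
      intervalIntegrable_const, intervalIntegral.integral_const, Complex.real_smul]
  rw [h1, ← abs_of_nonneg (sub_nonneg.2 hab)]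
  refine intervalIntegral.norm_integral_le_of_norm_le_const fun s hs => ?_
  rw [Set.uIoc_of_le hab] at hs
  exact hM s ⟨hs.1.le, hs.2⟩

/-- Away from the input, `ζ` moves along a straight line. -/
theorem norm_fst_sub_le (h : SlowDynamics σ ω ζ η) (hσ : Continuous σ) {a b M : ℝ} (ha : 0 ≤ a)
    (hab : a ≤ b) (v : ℂ) (hM : ∀ s ∈ Set.Icc a b, ‖η s - v‖ ≤ M) :
    ‖ζ b - ζ a - (b - a : ℝ) * v‖ ≤ M * (b - a) + ∫ s in a..b, |rotInput σ ω ζ s| := by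
  rw [h.fst_sub_eq hσ ha hab, sub_right_comm]
  refine (norm_sub_le _ _).trans (add_le_add (h.norm_integral_snd_sub_le hab v hM) ?_)
  rw [norm_mul, Complex.norm_I, one_mul]
  exact norm_integral_demodInput_le σ ω ζ hab

theorem integral_abs_rotInput_mono (h : SlowDynamics σ ω ζ η) (hσ : Continuous σ) {a b c d : ℝ}
    (hca : c ≤ a) (hab : a ≤ b) (hbd : b ≤ d) :
    ∫ s in a..b, |rotInput σ ω ζ s| ≤ ∫ s in c..d, |rotInput σ ω ζ s| :=
  intervalIntegral.integral_mono_interval hca hab hbd (Eventually.of_forall fun _ => abs_nonneg _)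
    ((h.continuous_rotInput hσ).abs.intervalIntegrable _ _)

end SlowDynamics

/-! ### Mass, change and mean of the input over a period -/

/-- The mass of the input over the period that starts at `t`. -/
noncomputable def inputMass (σ : ℝ → ℝ) (ω T : ℝ) (ζ : ℝ → ℂ) (t : ℝ) : ℝ :=
  ∫ s in t..(t + T), |rotInput σ ω ζ s|

/-- The mass, over the period that starts at `t`, of the change of the input in one period. -/
noncomputable def inputChange (σ : ℝ → ℝ) (ω T : ℝ) (ζ : ℝ → ℂ) (t : ℝ) : ℝ :=
  ∫ s in t..(t + T), |rotInput σ ω ζ s - rotInput σ ω ζ (s - T)|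

/-- The averaged input in the rotating frame over the period that starts at `t`. -/
noncomputable def inputMean (σ : ℝ → ℝ) (ω T : ℝ) (ζ : ℝ → ℂ) (t : ℝ) : ℂ :=
  ∫ s in t..(t + T), demodInput σ ω ζ s

theorem inputMass_nonneg (σ : ℝ → ℝ) (ω : ℝ) {T : ℝ} (hT : 0 ≤ T) (ζ : ℝ → ℂ) (t : ℝ) :
    0 ≤ inputMass σ ω T ζ t :=
  intervalIntegral.integral_nonneg (by linarith) fun _ _ => abs_nonneg _

theorem inputChange_nonneg (σ : ℝ → ℝ) (ω : ℝ) {T : ℝ} (hT : 0 ≤ T) (ζ : ℝ → ℂ) (t : ℝ) :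
    0 ≤ inputChange σ ω T ζ t :=
  intervalIntegral.integral_nonneg (by linarith) fun _ _ => abs_nonneg _

namespace SlowDynamics

variable {σ : ℝ → ℝ} {ω T l : ℝ} {ζ η : ℝ → ℂ}

theorem norm_inputMean_le (hT : 0 ≤ T) (t : ℝ) :
    ‖inputMean σ ω T ζ t‖ ≤ inputMass σ ω T ζ t :=
  norm_integral_demodInput_le σ ω ζ (by linarith)

theorem integral_change_le (h : SlowDynamics σ ω ζ η) (hσ : Continuous σ) {t₁ t : ℝ}
    (ht : t ∈ Set.Icc t₁ (t₁ + T)) :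
    ∫ s in t..(t₁ + T), |rotInput σ ω ζ s - rotInput σ ω ζ (s - T)| ≤ inputChange σ ω T ζ t₁ := by
  have hu := h.continuous_rotInput hσ
  exact intervalIntegral.integral_mono_interval ht.1 ht.2 le_rfl
    (Eventually.of_forall fun _ => abs_nonneg _)
    ((by fun_prop : Continuous fun s =>
      |rotInput σ ω ζ s - rotInput σ ω ζ (s - T)|).intervalIntegrable _ _)

/-- The mass of the input over a shifted period. -/
theorem integral_abs_rotInput_le (h : SlowDynamics σ ω ζ η) (hσ : Continuous σ) {t₁ t : ℝ}
    (ht : t ∈ Set.Icc t₁ (t₁ + T)) :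
    ∫ s in (t - T)..t, |rotInput σ ω ζ s| ≤ inputMass σ ω T ζ t₁ + inputChange σ ω T ζ t₁ := by
  have hu := h.continuous_rotInput hσ
  have hi : ∀ a b, IntervalIntegrable (fun s => |rotInput σ ω ζ s|) MeasureTheory.volume a b :=
    fun a b => hu.abs.intervalIntegrable a b
  have hd : Continuous fun s => |rotInput σ ω ζ s - rotInput σ ω ζ (s - T)| := by fun_prop
  have hs : Continuous fun s => |rotInput σ ω ζ (s - T)| := by fun_prop
  -- The two windows overlap on [t₁, t]; the remaining part of one is the remaining part of the
  -- other shifted by a period, so exchanging them costs at most the change of the input.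
  have h1 : ∫ s in (t - T)..t₁, |rotInput σ ω ζ s|
      = ∫ s in t..(t₁ + T), |rotInput σ ω ζ (s - T)| := by
    rw [intervalIntegral.integral_comp_sub_right (fun s => |rotInput σ ω ζ s|), add_sub_cancel_right]
  have h2 : ∫ s in t..(t₁ + T), |rotInput σ ω ζ (s - T)| ≤ ∫ s in t..(t₁ + T),
      (|rotInput σ ω ζ s| + |rotInput σ ω ζ s - rotInput σ ω ζ (s - T)|) := by
    refine intervalIntegral.integral_mono_on ht.2 (hs.intervalIntegrable _ _)
      ((hi _ _).add (hd.intervalIntegrable _ _)) fun s _ => ?_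
    have := abs_sub_abs_le_abs_sub (rotInput σ ω ζ (s - T)) (rotInput σ ω ζ s)
    rw [abs_sub_comm] at this
    linarith
  rw [intervalIntegral.integral_add (hi _ _) (hd.intervalIntegrable _ _)] at h2
  have h3 := h.integral_change_le hσ ht
  have h4 := intervalIntegral.integral_add_adjacent_intervals (hi (t - T) t₁) (hi t₁ t)
  have h5 := intervalIntegral.integral_add_adjacent_intervals (hi t₁ t) (hi t (t₁ + T))
  rw [inputMass, ← h5, ← h4]
  linarith

/-- Sliding the window replaces the values on [t, t₁ + T] by those one period earlier. The carrier
has period T, so only the change of the scalar input contributes. -/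
theorem norm_inputMean_sub_le (h : SlowDynamics σ ω ζ η) (hσ : Continuous σ)
    (hT : ω * T = 2 * Real.pi) {t₁ t : ℝ} (ht : t ∈ Set.Icc t₁ (t₁ + T)) :
    ‖inputMean σ ω T ζ t₁ - ∫ s in (t - T)..t, demodInput σ ω ζ s‖ ≤ inputChange σ ω T ζ t₁ := by
  have hc := h.continuous_demodInput hσ
  have hi : ∀ a b, IntervalIntegrable (demodInput σ ω ζ) MeasureTheory.volume a b :=
    fun a b => hc.intervalIntegrable a b
  have h1 : ∫ s in (t - T)..t₁, demodInput σ ω ζ s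
      = ∫ s in t..(t₁ + T), demodInput σ ω ζ (s - T) := by
    rw [intervalIntegral.integral_comp_sub_right (fun s => demodInput σ ω ζ s),
      add_sub_cancel_right]
  have h2 : inputMean σ ω T ζ t₁ - ∫ s in (t - T)..t, demodInput σ ω ζ s
      = ∫ s in t..(t₁ + T), (demodInput σ ω ζ s - demodInput σ ω ζ (s - T)) := by
    rw [intervalIntegral.integral_sub (hi _ _)
      ((by fun_prop : Continuous fun s => demodInput σ ω ζ (s - T)).intervalIntegrable _ _),
      ← h1, inputMean, ← intervalIntegral.integral_add_adjacent_intervals (hi t₁ t) (hi t _),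
      ← intervalIntegral.integral_add_adjacent_intervals (hi (t - T) t₁) (hi t₁ t)]
    ring
  rw [h2]
  refine (intervalIntegral.norm_integral_le_integral_norm ht.2).trans ?_
  simp only [demodInput_sub_period hT]
  exact h.integral_change_le hσ ht

end SlowDynamics

/-! ### The averaged energy and its balance over one period -/

/-- The averaged energy: kinetic energy plus the mean potential energy over the last period. -/
noncomputable def slowEnergy (σ : ℝ → ℝ) (ω T : ℝ) (ζ η : ℝ → ℂ) (t : ℝ) : ℝ :=
  T / 2 * ‖η t‖ ^ 2 + ∫ s in (t - T)..t, satPotential σ (rotOutput ω ζ s)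

theorem inner_demodInput (σ : ℝ → ℝ) (ω : ℝ) (ζ : ℝ → ℂ) (t : ℝ) (v : ℂ) :
    inner ℝ v (demodInput σ ω ζ t) = rotInput σ ω ζ t * (carrier ω t * v).re := by
  rw [Complex.inner, demodInput]
  simp
  ring

theorem rotOutput_eq (ω : ℝ) (ζ : ℝ → ℂ) (t : ℝ) :
    rotOutput ω ζ t = ‖ζ t‖ * Real.sin (ω * t + (ζ t).arg) := by
  rw [rotOutput]
  conv_lhs => rw [← Complex.norm_mul_exp_arg_mul_I (ζ t)]
  rw [carrier, mul_left_comm, ← Complex.exp_add, ← add_mul, ← Complex.ofReal_add,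
    Complex.im_ofReal_mul, Complex.exp_ofReal_mul_I_im]

namespace SlowDynamics

variable {σ : ℝ → ℝ} {ω T l : ℝ} {ζ η : ℝ → ℂ}

/-- Used twice: with v the mean itself it produces the damping term, and with v a unit vector it
extracts a first harmonic of the input. -/
theorem inner_inputMean (h : SlowDynamics σ ω ζ η) (hσ : Continuous σ) (t : ℝ) (v : ℂ) :
    ∫ s in t..(t + T), rotInput σ ω ζ s * (carrier ω s * v).re
      = inner ℝ v (inputMean σ ω T ζ t) := by
  simp only [← inner_demodInput]
  exact (innerSL ℝ v).intervalIntegral_comp_comm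
    ((h.continuous_demodInput hσ).intervalIntegrable _ _)

theorem hasDerivAt_norm_sq_snd (h : SlowDynamics σ ω ζ η) {t : ℝ} (ht : 0 < t) :
    HasDerivAt (fun s => ‖η s‖ ^ 2) (-(2 * rotInput σ ω ζ t * (carrier ω t * η t).im)) t := by
  have h1 := (h.deriv_snd t ht).norm_sq
  have h2 : inner ℝ (η t) (-(Complex.I * demodInput σ ω ζ t))
      = -(rotInput σ ω ζ t * (carrier ω t * η t).im) := by
    rw [Complex.inner, demodInput]
    simp
    ring
  rw [h2] at h1
  convert h1 using 1
  ring

/-- The displacement of `ζ` over one period. -/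
theorem norm_fst_delay_le (h : SlowDynamics σ ω ζ η) (hσ : Continuous σ) (hT : 0 ≤ T) {t : ℝ}
    (ht : T ≤ t) :
    ‖ζ t - ζ (t - T) - (T * η t - Complex.I * ∫ s in (t - T)..t, demodInput σ ω ζ s)‖
      ≤ T * ∫ s in (t - T)..t, |rotInput σ ω ζ s| := by
  have hle : t - T ≤ t := by linarith
  have h0 : 0 ≤ t - T := by linarith
  have h1 := h.norm_integral_snd_sub_le hle (η t) (M := ∫ s in (t - T)..t, |rotInput σ ω ζ s|) ?_
  · rw [sub_sub_cancel] at h1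
    rw [h.fst_sub_eq hσ h0 hle, sub_sub_sub_cancel_right, mul_comm T]
    exact h1
  · intro s hs
    rw [norm_sub_rev]
    exact (h.norm_snd_sub_le hσ (h0.trans hs.1) hs.2).trans
      (h.integral_abs_rotInput_mono hσ hs.1 hs.2 le_rfl)

/-- The instantaneous balance of the averaged energy. -/
theorem energy_density_le (h : SlowDynamics σ ω ζ η) (hσ : IsSaturation σ) (hl : 0 < l)
    (hlip : ∀ a b, |σ a - σ b| ≤ l * |a - b|) (hωT : ω * T = 2 * Real.pi) (hT : 0 ≤ T) {t : ℝ}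
    (ht : T ≤ t) :
    satPotential σ (rotOutput ω ζ t) - satPotential σ (rotOutput ω ζ (t - T))
      - T * (rotInput σ ω ζ t * (carrier ω t * η t).im)
    ≤ -((rotInput σ ω ζ t - rotInput σ ω ζ (t - T)) ^ 2 / (2 * l))
      - rotInput σ ω ζ t * (carrier ω t * ∫ s in (t - T)..t, demodInput σ ω ζ s).re
      + |rotInput σ ω ζ t| * (T * ∫ s in (t - T)..t, |rotInput σ ω ζ s|) := by
  have h1 := satPotential_sub_le hσ.odd hσ.mono hl hlip hσ.continuous (rotOutput ω ζ t)
    (rotOutput ω ζ (t - T))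
  set c := ∫ s in (t - T)..t, demodInput σ ω ζ s with hc
  -- The displacement of ζ over a period splits into the drift T η, the integrated input and a
  -- remainder. The drift term is exactly what the kinetic energy loses.
  have h2 : rotOutput ω ζ t - rotOutput ω ζ (t - T) = T * (carrier ω t * η t).im
      - (carrier ω t * c).re
      + (carrier ω t * (ζ t - ζ (t - T) - (T * η t - Complex.I * c))).im := by
    rw [rotOutput_sub_period hωT, rotOutput]
    simp only [Complex.mul_im, Complex.mul_re, Complex.sub_re, Complex.sub_im, Complex.ofReal_re,
      Complex.ofReal_im, Complex.I_re, Complex.I_im]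
    ring
  have h3 : |(carrier ω t * (ζ t - ζ (t - T) - (T * η t - Complex.I * c))).im|
      ≤ T * ∫ s in (t - T)..t, |rotInput σ ω ζ s| := by
    refine (Complex.abs_im_le_norm _).trans ?_
    rw [norm_mul, norm_carrier, one_mul]
    exact h.norm_fst_delay_le hσ.continuous hT ht
  set e := (carrier ω t * (ζ t - ζ (t - T) - (T * η t - Complex.I * c))).im
  have h4 : rotInput σ ω ζ t * e
      ≤ |rotInput σ ω ζ t| * (T * ∫ s in (t - T)..t, |rotInput σ ω ζ s|) :=
    (le_abs_self _).trans ((abs_mul _ _).trans_le (by gcongr))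
  rw [h2] at h1
  simp only [rotInput] at h4 ⊢
  linarith

/-- The energy density, with the mean of the input frozen at the beginning of a period. -/
theorem energy_density_le_of_mem (h : SlowDynamics σ ω ζ η) (hσ : IsSaturation σ) (hl : 0 < l)
    (hlip : ∀ a b, |σ a - σ b| ≤ l * |a - b|) (hωT : ω * T = 2 * Real.pi) (hT : 0 < T) {t₁ t : ℝ}
    (ht₁ : T ≤ t₁) (ht : t ∈ Set.Icc t₁ (t₁ + T)) :
    satPotential σ (rotOutput ω ζ t) - satPotential σ (rotOutput ω ζ (t - T))
      - T * (rotInput σ ω ζ t * (carrier ω t * η t).im)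
    ≤ (inputChange σ ω T ζ t₁ / T) ^ 2 / (2 * l)
      - inputChange σ ω T ζ t₁ / T / l * |rotInput σ ω ζ t - rotInput σ ω ζ (t - T)|
      - rotInput σ ω ζ t * (carrier ω t * inputMean σ ω T ζ t₁).re
      + |rotInput σ ω ζ t| * (inputChange σ ω T ζ t₁
        + T * (inputMass σ ω T ζ t₁ + inputChange σ ω T ζ t₁)) := by
  have h1 := h.energy_density_le hσ hl hlip hωT hT.le (ht₁.trans ht.1)
  have h2 := h.integral_abs_rotInput_le hσ.continuous ht
  have h3 := h.norm_inputMean_sub_le hσ.continuous hωT ht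
  set c := ∫ s in (t - T)..t, demodInput σ ω ζ s
  set D := inputChange σ ω T ζ t₁
  set u := rotInput σ ω ζ t
  have h4 : |(carrier ω t * (inputMean σ ω T ζ t₁ - c)).re| ≤ D := by
    refine (Complex.abs_re_le_norm _).trans ?_
    rwa [norm_mul, norm_carrier, one_mul]
  have h5 : u * (carrier ω t * (inputMean σ ω T ζ t₁ - c)).re ≤ |u| * D :=
    (le_abs_self _).trans ((abs_mul _ _).trans_le (by gcongr))
  rw [mul_sub, Complex.sub_re] at h5
  have h6 : |u| * (T * ∫ s in (t - T)..t, |rotInput σ ω ζ s|)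
      ≤ |u| * (T * (inputMass σ ω T ζ t₁ + D)) := by gcongr
  set d := u - rotInput σ ω ζ (t - T)
  -- The square of the change is replaced by its tangent line at the average D/T. After integration
  -- this yields D²/(2lT), as Cauchy–Schwarz would.
  have h7 : (D / T) ^ 2 / (2 * l) - D / T / l * |d| + d ^ 2 / (2 * l)
      = (|d| - D / T) ^ 2 / (2 * l) := by
    rw [← sq_abs d]
    field_simp
    ring
  have h8 : 0 ≤ (|d| - D / T) ^ 2 / (2 * l) := by positivity
  linarith

/-- The decay of the averaged energy over one period. -/
theorem slowEnergy_add_period_le (h : SlowDynamics σ ω ζ η) (hσ : IsSaturation σ) (hl : 0 < l)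
    (hlip : ∀ a b, |σ a - σ b| ≤ l * |a - b|) (hωT : ω * T = 2 * Real.pi) (hT : 0 < T) {t₁ : ℝ}
    (ht₁ : T ≤ t₁) :
    slowEnergy σ ω T ζ η (t₁ + T) ≤ slowEnergy σ ω T ζ η t₁
      - inputChange σ ω T ζ t₁ ^ 2 / (2 * l * T) - ‖inputMean σ ω T ζ t₁‖ ^ 2
      + inputMass σ ω T ζ t₁ * (inputChange σ ω T ζ t₁
        + T * (inputMass σ ω T ζ t₁ + inputChange σ ω T ζ t₁)) := by
  have hu := h.continuous_rotInput hσ.continuous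
  have hη := h.continuous_snd
  have hE := continuous_carrier ω
  have hS : Continuous fun s => satPotential σ (rotOutput ω ζ s) :=
    (continuous_satPotential hσ.continuous).comp h.continuous_rotOutput
  have hST : Continuous fun s => satPotential σ (rotOutput ω ζ (s - T)) :=
    hS.comp (continuous_sub_right T)
  have hQ : Continuous fun t => rotInput σ ω ζ t * (carrier ω t * η t).im :=
    hu.mul (Complex.continuous_im.comp (hE.mul hη))
  have hle : t₁ ≤ t₁ + T := by linarith
  have hkin : ‖η (t₁ + T)‖ ^ 2 - ‖η t₁‖ ^ 2
      = ∫ t in t₁..(t₁ + T), -(2 * rotInput σ ω ζ t * (carrier ω t * η t).im) := by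
    refine (intervalIntegral.integral_eq_sub_of_hasDerivAt_of_le hle
      (hη.norm.pow 2).continuousOn
      (fun t ht => h.hasDerivAt_norm_sq_snd (by linarith [ht.1])) ?_).symm
    simp only [mul_assoc]
    exact (hQ.const_mul 2).neg.intervalIntegrable _ _
  have hkin' : T / 2 * ‖η (t₁ + T)‖ ^ 2 - T / 2 * ‖η t₁‖ ^ 2
      = -∫ t in t₁..(t₁ + T), T * (rotInput σ ω ζ t * (carrier ω t * η t).im) := by
    rw [← mul_sub, hkin, ← intervalIntegral.integral_const_mul, ← intervalIntegral.integral_neg]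
    congr 1
    ext t
    ring
  have hpot : ∫ s in (t₁ - T)..t₁, satPotential σ (rotOutput ω ζ s)
      = ∫ s in t₁..(t₁ + T), satPotential σ (rotOutput ω ζ (s - T)) := by
    rw [intervalIntegral.integral_comp_sub_right (fun s => satPotential σ (rotOutput ω ζ s)),
      add_sub_cancel_right]
  set A := inputMass σ ω T ζ t₁ with hA
  set D := inputChange σ ω T ζ t₁ with hD
  set C := inputMean σ ω T ζ t₁ with hC
  have hd : Continuous fun s => |rotInput σ ω ζ s - rotInput σ ω ζ (s - T)| := by fun_prop
  have hc : Continuous fun t => rotInput σ ω ζ t * (carrier ω t * C).re :=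
    hu.mul (Complex.continuous_re.comp (hE.mul continuous_const))
  have hSS : Continuous fun s => satPotential σ (rotOutput ω ζ s)
      - satPotential σ (rotOutput ω ζ (s - T)) := hS.sub hST
  have hTQ : Continuous fun t => T * (rotInput σ ω ζ t * (carrier ω t * η t).im) :=
    hQ.const_mul T
  have hd' : Continuous fun s => D / T / l * |rotInput σ ω ζ s - rotInput σ ω ζ (s - T)| :=
    hd.const_mul _
  have hu' : Continuous fun s => |rotInput σ ω ζ s| * (D + T * (A + D)) := hu.abs.mul_const _
  have hR₁ : Continuous fun s => (D / T) ^ 2 / (2 * l)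
      - D / T / l * |rotInput σ ω ζ s - rotInput σ ω ζ (s - T)| := continuous_const.sub hd'
  have hR₂ : Continuous fun s => (D / T) ^ 2 / (2 * l)
      - D / T / l * |rotInput σ ω ζ s - rotInput σ ω ζ (s - T)|
      - rotInput σ ω ζ s * (carrier ω s * C).re := hR₁.sub hc
  have hmain := intervalIntegral.integral_mono_on (μ := MeasureTheory.volume) hle
    (Continuous.intervalIntegrable (u := fun s => satPotential σ (rotOutput ω ζ s)
      - satPotential σ (rotOutput ω ζ (s - T))
      - T * (rotInput σ ω ζ s * (carrier ω s * η s).im)) (hSS.sub hTQ) t₁ (t₁ + T))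
    (Continuous.intervalIntegrable (u := fun s => (D / T) ^ 2 / (2 * l)
      - D / T / l * |rotInput σ ω ζ s - rotInput σ ω ζ (s - T)|
      - rotInput σ ω ζ s * (carrier ω s * C).re
      + |rotInput σ ω ζ s| * (D + T * (A + D))) (hR₂.add hu') t₁ (t₁ + T))
    (fun t ht => h.energy_density_le_of_mem hσ hl hlip hωT hT ht₁ ht)
  -- The mean C was frozen so that it leaves the integral: the input tested against C integrates to
  -- ‖C‖².
  rw [intervalIntegral.integral_sub (hSS.intervalIntegrable _ _) (hTQ.intervalIntegrable _ _),
    intervalIntegral.integral_sub (hS.intervalIntegrable _ _) (hST.intervalIntegrable _ _),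
    intervalIntegral.integral_add (hR₂.intervalIntegrable _ _) (hu'.intervalIntegrable _ _),
    intervalIntegral.integral_sub (hR₁.intervalIntegrable _ _) (hc.intervalIntegrable _ _),
    intervalIntegral.integral_sub intervalIntegrable_const (hd'.intervalIntegrable _ _),
    intervalIntegral.integral_const, intervalIntegral.integral_const_mul (D / T / l),
    intervalIntegral.integral_mul_const, h.inner_inputMean hσ.continuous, ← hC, ← hpot,
    real_inner_self_eq_norm_sq, add_sub_cancel_left, smul_eq_mul] at hmain
  have e1 : ∫ s in t₁..(t₁ + T), |rotInput σ ω ζ s - rotInput σ ω ζ (s - T)| = D := rfl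
  have e2 : ∫ s in t₁..(t₁ + T), |rotInput σ ω ζ s| = A := rfl
  rw [e1, e2] at hmain
  have e3 : T * ((D / T) ^ 2 / (2 * l)) - D / T / l * D = -(D ^ 2 / (2 * l * T)) := by
    field_simp
    ring
  rw [slowEnergy, slowEnergy, add_sub_cancel_right]
  linarith

end SlowDynamics

/-! ### Comparison of the input with the response to a sinusoid -/

theorem integral_sin_sq_period {ω T : ℝ} (hωT : ω * T = 2 * Real.pi) (hω : ω ≠ 0) (t α : ℝ) :
    ∫ s in t..(t + T), Real.sin (ω * s + α) ^ 2 = T / 2 := by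
  rw [intervalIntegral.integral_comp_mul_add (fun x => Real.sin x ^ 2) hω, integral_sin_sq,
    show ω * (t + T) + α = ω * t + α + 2 * Real.pi by rw [mul_add, hωT]; ring,
    Real.sin_add_two_pi, Real.cos_add_two_pi, ← hωT, smul_eq_mul]
  field_simp
  ring

/-- If `p` and `q` lie, up to an error `E`, on two sides of `x`, then `σ x` is close to `σ p`. -/
theorem abs_sub_le_of_between {σ : ℝ → ℝ} (hmono : Monotone σ) {l : ℝ}
    (hlip : ∀ a b, |σ a - σ b| ≤ l * |a - b|) {p q x g a b E : ℝ} (ha : 0 ≤ a) (hb : 0 ≤ b)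
    (hp : |p - (x + a * g)| ≤ E) (hq : |q - (x - b * g)| ≤ E) :
    |σ p - σ x| ≤ |σ p - σ q| + l * E := by
  have hE : 0 ≤ E := (abs_nonneg _).trans hp
  have hshift : ∀ z, |σ (z + E) - σ z| ≤ l * E ∧ |σ (z - E) - σ z| ≤ l * E := fun z =>
    ⟨(hlip _ _).trans_eq (by rw [add_sub_cancel_left, abs_of_nonneg hE]),
      (hlip _ _).trans_eq (by rw [sub_sub_cancel_left, abs_neg, abs_of_nonneg hE])⟩
  have hp1 := abs_le.1 (hshift p).1
  have hp2 := abs_le.1 (hshift p).2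
  have hq1 := abs_le.1 (hshift q).1
  have hq2 := abs_le.1 (hshift q).2
  rw [abs_le] at hp hq
  have hd1 := le_abs_self (σ p - σ q)
  have hd2 := neg_abs_le (σ p - σ q)
  have hd3 := abs_nonneg (σ p - σ q)
  rcases le_total 0 g with hg | hg
  · have h1 := mul_nonneg ha hg
    have h2 := mul_nonneg hb hg
    have h3 : σ x ≤ σ (p + E) := hmono (by linarith [hp.1])
    have h4 : σ (q - E) ≤ σ x := hmono (by linarith [hq.2])
    rw [abs_le]
    constructor <;> linarith
  · have h1 := mul_nonpos_of_nonneg_of_nonpos ha hg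
    have h2 := mul_nonpos_of_nonneg_of_nonpos hb hg
    have h3 : σ x ≤ σ (q + E) := hmono (by linarith [hq.1])
    have h4 : σ (p - E) ≤ σ x := hmono (by linarith [hp.2])
    rw [abs_le]
    constructor <;> linarith

namespace SlowDynamics

variable {σ : ℝ → ℝ} {ω T l : ℝ} {ζ η : ℝ → ℂ}

/-- Over one period, the input is close to the response to a sinusoid. -/
theorem abs_rotInput_sub_le (h : SlowDynamics σ ω ζ η) (hσ : IsSaturation σ)
    (hlip : ∀ a b, |σ a - σ b| ≤ l * |a - b|) (hωT : ω * T = 2 * Real.pi) (hT : 0 < T) {t₁ s : ℝ}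
    (ht₁ : T ≤ t₁) (hs : s ∈ Set.Icc t₁ (t₁ + T)) :
    |rotInput σ ω ζ s - σ (‖ζ t₁‖ * Real.sin (ω * s + (ζ t₁).arg))|
      ≤ |rotInput σ ω ζ s - rotInput σ ω ζ (s - T)|
        + l * ((1 + T) * (inputMass σ ω T ζ t₁ + inputChange σ ω T ζ t₁)) := by
  have hA := inputMass_nonneg σ ω hT.le ζ t₁
  have hD := inputChange_nonneg σ ω hT.le ζ t₁
  set A := inputMass σ ω T ζ t₁ with hAdef
  set D := inputChange σ ω T ζ t₁
  have hfwd : ∀ r ∈ Set.Icc t₁ s, ∫ x in t₁..r, |rotInput σ ω ζ x| ≤ A := fun r hr =>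
    h.integral_abs_rotInput_mono hσ.continuous le_rfl hr.1 (hr.2.trans hs.2)
  have hprev := h.integral_abs_rotInput_le hσ.continuous
    (Set.left_mem_Icc.2 (by linarith) : t₁ ∈ Set.Icc t₁ (t₁ + T))
  have hbwd : ∀ r ∈ Set.Icc (s - T) t₁, ∫ x in r..t₁, |rotInput σ ω ζ x| ≤ A + D := fun r hr =>
    (h.integral_abs_rotInput_mono hσ.continuous (by linarith [hr.1, hs.1]) hr.2 le_rfl).trans hprev
  have e1 := h.norm_fst_sub_le hσ.continuous (hT.le.trans ht₁) hs.1 (η t₁) (M := A)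
    fun r hr => (h.norm_snd_sub_le hσ.continuous (hT.le.trans ht₁) hr.1).trans (hfwd r hr)
  have hsT : s - T ≤ t₁ := by linarith [hs.2]
  have hsT0 : 0 ≤ s - T := by linarith [hs.1]
  have e2 := h.norm_fst_sub_le hσ.continuous hsT0 hsT (η t₁) (M := A + D)
    fun r hr => by
      rw [norm_sub_rev]
      exact (h.norm_snd_sub_le hσ.continuous (hsT0.trans hr.1) hr.2).trans (hbwd r hr)
  have e1' : ‖ζ s - ζ t₁ - (s - t₁ : ℝ) * η t₁‖ ≤ (1 + T) * (A + D) := by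
    refine (e1.trans (add_le_add_right (hfwd s ⟨hs.1, le_rfl⟩) _)).trans ?_
    have h1 : A * (s - t₁) ≤ A * T := by
      gcongr
      linarith [hs.2]
    nlinarith [mul_nonneg hT.le hD]
  have e2' : ‖ζ t₁ - ζ (s - T) - (t₁ - (s - T) : ℝ) * η t₁‖ ≤ (1 + T) * (A + D) := by
    refine (e2.trans (add_le_add_right (hbwd (s - T) ⟨le_rfl, hsT⟩) _)).trans ?_
    have h1 : (A + D) * (t₁ - (s - T)) ≤ (A + D) * T := by
      gcongr
      linarith [hs.1]
    linarith
  have hcar : ∀ z : ℂ, |(carrier ω s * z).im| ≤ ‖z‖ := fun z => by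
    simpa [norm_mul, norm_carrier] using Complex.abs_im_le_norm (carrier ω s * z)
  have hx : ‖ζ t₁‖ * Real.sin (ω * s + (ζ t₁).arg) = (carrier ω s * ζ t₁).im :=
    (rotOutput_eq ω (fun _ => ζ t₁) s).symm
  rw [hx]
  -- The times s and s - T lie on either side of t₁, so the drift g = Im(E η) enters with opposite
  -- signs. No bound on g is needed.
  refine abs_sub_le_of_between hσ.mono hlip (g := (carrier ω s * η t₁).im) (a := s - t₁)
    (b := t₁ - (s - T)) (by linarith [hs.1]) (by linarith) ?_ ?_
  · refine le_trans (le_of_eq ?_) ((hcar _).trans e1')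
    rw [rotOutput, mul_sub, mul_sub, mul_left_comm, Complex.sub_im, Complex.sub_im,
      Complex.im_ofReal_mul]
    congr 1
    ring
  · refine le_trans (le_of_eq ?_) ((hcar _).trans e2')
    rw [rotOutput_sub_period hωT, mul_sub, mul_sub, mul_left_comm, Complex.sub_im, Complex.sub_im,
      Complex.im_ofReal_mul, ← abs_neg]
    congr 1
    ring

/-- The response to a sinusoid of amplitude r never exceeds σ(r); integrating its distance to the
input gives the other terms. -/
theorem inputMass_le (h : SlowDynamics σ ω ζ η) (hσ : IsSaturation σ)
    (hlip : ∀ a b, |σ a - σ b| ≤ l * |a - b|) (hωT : ω * T = 2 * Real.pi) (hT : 0 < T) {t₁ : ℝ}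
    (ht₁ : T ≤ t₁) :
    inputMass σ ω T ζ t₁ ≤ T * σ ‖ζ t₁‖ + inputChange σ ω T ζ t₁
      + T * (l * ((1 + T) * (inputMass σ ω T ζ t₁ + inputChange σ ω T ζ t₁))) := by
  have hu := h.continuous_rotInput hσ.continuous
  have hd : Continuous fun s => |rotInput σ ω ζ s - rotInput σ ω ζ (s - T)| := by fun_prop
  set R := l * ((1 + T) * (inputMass σ ω T ζ t₁ + inputChange σ ω T ζ t₁)) with hR
  have hmain := intervalIntegral.integral_mono_on (μ := MeasureTheory.volume)
    (f := fun s => |rotInput σ ω ζ s|)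
    (g := fun s => |rotInput σ ω ζ s - rotInput σ ω ζ (s - T)| + (σ ‖ζ t₁‖ + R))
    (by linarith : t₁ ≤ t₁ + T) (hu.abs.intervalIntegrable _ _)
    ((hd.add continuous_const).intervalIntegrable _ _) (fun s hs => ?_)
  · rw [intervalIntegral.integral_add (hd.intervalIntegrable _ _) intervalIntegrable_const,
      intervalIntegral.integral_const, smul_eq_mul, add_sub_cancel_left] at hmain
    rw [← inputMass, ← inputChange] at hmain
    linarith
  · have h1 := h.abs_rotInput_sub_le hσ hlip hωT hT ht₁ hs
    have h2 : |σ (‖ζ t₁‖ * Real.sin (ω * s + (ζ t₁).arg))| ≤ σ ‖ζ t₁‖ := by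
      rw [hσ.abs_map, abs_mul, abs_norm]
      exact hσ.mono (mul_le_of_le_one_right (norm_nonneg _) (Real.abs_sin_le_one _))
    have h3 := abs_sub_abs_le_abs_sub (rotInput σ ω ζ s)
      (σ (‖ζ t₁‖ * Real.sin (ω * s + (ζ t₁).arg)))
    rw [← hR] at h1
    linarith

/-- The first harmonic of the input controls the input. -/
theorem mul_le_norm_inputMean (h : SlowDynamics σ ω ζ η) (hσ : IsSaturation σ) {κ : ℝ}
    (hκ : 0 ≤ κ) (hhalf : ∀ r, 0 ≤ r → κ * σ r ≤ σ (r / 2))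
    (hlip : ∀ a b, |σ a - σ b| ≤ l * |a - b|) (hωT : ω * T = 2 * Real.pi) (hT : 0 < T) {t₁ : ℝ}
    (ht₁ : T ≤ t₁) :
    κ / 8 * (T * σ ‖ζ t₁‖) ≤ ‖inputMean σ ω T ζ t₁‖ + inputChange σ ω T ζ t₁
      + T * (l * ((1 + T) * (inputMass σ ω T ζ t₁ + inputChange σ ω T ζ t₁))) := by
  have hu := h.continuous_rotInput hσ.continuous
  have hd : Continuous fun s => |rotInput σ ω ζ s - rotInput σ ω ζ (s - T)| := by fun_prop
  have hω : ω ≠ 0 := by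
    rintro rfl
    rw [zero_mul] at hωT
    exact (Real.two_pi_pos.ne hωT)
  set R := l * ((1 + T) * (inputMass σ ω T ζ t₁ + inputChange σ ω T ζ t₁)) with hR
  have hσr := hσ.nonneg (norm_nonneg (ζ t₁))
  set r := ‖ζ t₁‖ with hr
  set φ : ℝ → ℝ := fun s => Real.sin (ω * s + (ζ t₁).arg) with hφ
  have hφc : Continuous φ := by fun_prop
  have hφsq : Continuous fun s => φ s ^ 2 := hφc.pow 2
  have hφ1 : ∀ s, |φ s| ≤ 1 := fun s => Real.abs_sin_le_one _
  have hφ2 : ∫ s in t₁..(t₁ + T), φ s ^ 2 = T / 2 := integral_sin_sq_period hωT hω _ _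
  -- Where |φ| ≤ 1/2 the left side is nonpositive; elsewhere σ(r|φ|) ≥ σ(r/2) ≥ κ σ(r). The shift
  -- 1/4 leaves T/2 - T/4 after integration, whence κ/8.
  have hsin : ∀ s, κ / 2 * σ r * (φ s ^ 2 - 1 / 4) ≤ σ (r * φ s) * φ s := by
    intro s
    have hodd : σ (r * φ s) * φ s = σ (r * |φ s|) * |φ s| := by
      rcases le_total 0 (φ s) with h0 | h0
      · rw [abs_of_nonneg h0]
      · rw [abs_of_nonpos h0, mul_neg r, hσ.odd, neg_mul_neg]
    rw [hodd, ← sq_abs]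
    have h0 := abs_nonneg (φ s)
    have h1 := hφ1 s
    set x := |φ s|
    have hk : 0 ≤ κ / 2 * σ r := by positivity
    rcases le_total x (1 / 2) with h2 | h2
    · have h3 : κ / 2 * σ r * (x ^ 2 - 1 / 4) ≤ 0 :=
        mul_nonpos_of_nonneg_of_nonpos hk (by nlinarith)
      exact h3.trans (mul_nonneg (hσ.nonneg (mul_nonneg (norm_nonneg _) h0)) h0)
    · have h3 : σ (r / 2) ≤ σ (r * x) := hσ.mono (by
        have := mul_le_mul_of_nonneg_left h2 (norm_nonneg (ζ t₁))
        linarith)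
      have h4 := (hhalf r (norm_nonneg _)).trans h3
      calc κ / 2 * σ r * (x ^ 2 - 1 / 4) ≤ κ / 2 * σ r * 1 := by
            gcongr
            nlinarith
        _ = κ * σ r * (1 / 2) := by ring
        _ ≤ σ (r * x) * x := by
            have : 0 ≤ κ * σ r := by positivity
            gcongr
            linarith
  have huφ : Continuous fun s => rotInput σ ω ζ s * φ s := hu.mul hφc
  have hdR : Continuous fun s => |rotInput σ ω ζ s - rotInput σ ω ζ (s - T)| + R :=
    hd.add continuous_const
  have hmain := intervalIntegral.integral_mono_on (μ := MeasureTheory.volume)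
    (f := fun s => κ / 2 * σ r * (φ s ^ 2 - 1 / 4))
    (g := fun s => rotInput σ ω ζ s * φ s
      + (|rotInput σ ω ζ s - rotInput σ ω ζ (s - T)| + R))
    (by linarith : t₁ ≤ t₁ + T)
    ((by fun_prop : Continuous fun s => κ / 2 * σ r * (φ s ^ 2 - 1 / 4)).intervalIntegrable _ _)
    ((huφ.add hdR).intervalIntegrable _ _) (fun s hs => ?_)
  · have hmean : ∫ s in t₁..(t₁ + T), rotInput σ ω ζ s * φ s ≤ ‖inputMean σ ω T ζ t₁‖ := by
      -- The unit vector whose rotation by the carrier has real part φ.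
      set v : ℂ := -Complex.I * Complex.exp ((ζ t₁).arg * Complex.I) with hv
      have h1 : ∀ s, φ s = (carrier ω s * v).re := by
        intro s
        have h2 : carrier ω s * v
            = -Complex.I * Complex.exp ((ω * s + (ζ t₁).arg : ℝ) * Complex.I) := by
          rw [hv, carrier, mul_left_comm, ← Complex.exp_add, ← add_mul, ← Complex.ofReal_add]
        rw [h2, neg_mul, Complex.neg_re, Complex.I_mul_re, Complex.exp_ofReal_mul_I_im, neg_neg]
      simp only [h1]
      rw [h.inner_inputMean hσ.continuous]
      refine (real_inner_le_norm _ _).trans_eq ?_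
      rw [hv, norm_mul, norm_neg, Complex.norm_I, Complex.norm_exp_ofReal_mul_I, one_mul, one_mul]
    rw [intervalIntegral.integral_add (huφ.intervalIntegrable _ _) (hdR.intervalIntegrable _ _),
      intervalIntegral.integral_add (hd.intervalIntegrable _ _) intervalIntegrable_const,
      intervalIntegral.integral_const_mul, intervalIntegral.integral_sub
        (hφsq.intervalIntegrable _ _) intervalIntegrable_const, hφ2,
      intervalIntegral.integral_const, intervalIntegral.integral_const, smul_eq_mul, smul_eq_mul,
      add_sub_cancel_left, ← inputChange] at hmain
    linarith
  · have h1 := h.abs_rotInput_sub_le hσ hlip hωT hT ht₁ hs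
    have h2 := hsin s
    have h3 : (σ (r * φ s) - rotInput σ ω ζ s) * φ s
        ≤ |rotInput σ ω ζ s - rotInput σ ω ζ (s - T)| + R := by
      refine (le_abs_self _).trans ?_
      rw [abs_mul, abs_sub_comm]
      exact (mul_le_of_le_one_right (abs_nonneg _) (hφ1 s)).trans h1
    linarith

/-- Strict decay of the averaged energy, for fast rotations. -/
theorem slowEnergy_add_period_le_of_small (h : SlowDynamics σ ω ζ η) (hσ : IsSaturation σ)
    {κ : ℝ} (hκ : 0 < κ) (hκ1 : κ ≤ 1) (hhalf : ∀ r, 0 ≤ r → κ * σ r ≤ σ (r / 2)) (hl : 0 < l)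
    (hlip : ∀ a b, |σ a - σ b| ≤ l * |a - b|) (hωT : ω * T = 2 * Real.pi) (hT : 0 < T)
    (hT1 : T ≤ 1) (hTl : 64 * l * T ≤ κ) (hTκ : 2048 * T ≤ κ ^ 2)
    (hTlκ : 2 * l * T * (10 + 2048 / κ ^ 2) ≤ 1) {t₁ : ℝ} (ht₁ : T ≤ t₁) :
    slowEnergy σ ω T ζ η (t₁ + T) ≤ slowEnergy σ ω T ζ η t₁
      - κ ^ 2 / 1024 * inputMass σ ω T ζ t₁ ^ 2 - inputChange σ ω T ζ t₁ ^ 2 := by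
  have h1 := h.slowEnergy_add_period_le hσ hl hlip hωT hT ht₁
  have h2 := h.inputMass_le hσ hlip hωT hT ht₁
  have h3 := h.mul_le_norm_inputMean hσ hκ.le hhalf hlip hωT hT ht₁
  have hA := inputMass_nonneg σ ω hT.le ζ t₁
  have hD := inputChange_nonneg σ ω hT.le ζ t₁
  set A := inputMass σ ω T ζ t₁
  set D := inputChange σ ω T ζ t₁
  have hC := norm_nonneg (inputMean σ ω T ζ t₁)
  set C := ‖inputMean σ ω T ζ t₁‖
  have hκk : T * (l * ((1 + T) * (A + D))) ≤ κ / 32 * (A + D) := by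
    have h4 : T * l * (1 + T) ≤ T * l * 2 := by gcongr; linarith
    calc T * (l * ((1 + T) * (A + D))) = T * l * (1 + T) * (A + D) := by ring
      _ ≤ κ / 32 * (A + D) := by
        gcongr
        linarith
  set R := T * (l * ((1 + T) * (A + D)))
  have h4 : κ / 8 * A ≤ κ / 8 * (T * σ ‖ζ t₁‖ + D + κ / 32 * (A + D)) := by
    gcongr
    linarith
  -- Eliminating the amplitude T σ(‖ζ t₁‖) between the upper bound for A and the lower bound for C.
  -- The terms with a factor A on the right are absorbed by lowering κ/8 to κ/16.
  have h5 : κ / 16 * A ≤ C + 2 * D := by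
    have h6 : κ * κ * (A + D) ≤ κ * 1 * (A + D) := by gcongr
    have h7 : κ * D ≤ 1 * D := by gcongr
    have h8 : 0 ≤ κ * A := by positivity
    linarith
  have h6 : (κ / 16 * A) ^ 2 ≤ 2 * C ^ 2 + 8 * D ^ 2 := by
    have h7 : (κ / 16 * A) ^ 2 ≤ (C + 2 * D) ^ 2 := by gcongr
    have h8 := sq_nonneg (C - 2 * D)
    linarith
  -- Young's inequality, weighted so that A² costs κ²/2048. With T A² costing as much again, half of
  -- the gain κ²/512 from C² survives; the D² terms are paid by D²/(2lT).
  have h7 : 2 * (A * D) ≤ κ ^ 2 / 2048 * A ^ 2 + 2048 / κ ^ 2 * D ^ 2 := by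
    have h8 : κ ^ 2 / 2048 * A ^ 2 + 2048 / κ ^ 2 * D ^ 2 - 2 * (A * D)
        = 2048 / κ ^ 2 * (κ ^ 2 / 2048 * A - D) ^ 2 := by
      field_simp
      ring
    have h9 : 0 ≤ 2048 / κ ^ 2 * (κ ^ 2 / 2048 * A - D) ^ 2 := by positivity
    linarith
  have h8 : T * A ^ 2 ≤ κ ^ 2 / 2048 * A ^ 2 := by
    gcongr
    linarith
  have h9 : T * (A * D) ≤ 1 * (A * D) := by gcongr
  have h10 : (10 + 2048 / κ ^ 2) * D ^ 2 ≤ D ^ 2 / (2 * l * T) := by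
    rw [le_div_iff₀ (by positivity)]
    calc (10 + 2048 / κ ^ 2) * D ^ 2 * (2 * l * T)
        = 2 * l * T * (10 + 2048 / κ ^ 2) * D ^ 2 := by ring
      _ ≤ 1 * D ^ 2 := by gcongr
      _ = D ^ 2 := one_mul _
  have h11 := sq_nonneg D
  linarith

end SlowDynamics

/-! ### From energy decay to stability and convergence -/

/-- The rotation is fast enough, relative to the constants `κ` and `l` of the saturation, for the
averaged energy to decay. -/
structure FastRotation (κ l ω T : ℝ) : Prop where
  period : ω * T = 2 * Real.pi
  pos : 0 < T
  le_one : T ≤ 1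
  lipschitz_le : 64 * l * T ≤ κ
  le_sq : 2048 * T ≤ κ ^ 2
  damping : 2 * l * T * (10 + 2048 / κ ^ 2) ≤ 1

theorem abs_rotOutput_le (ω : ℝ) (ζ : ℝ → ℂ) (t : ℝ) : |rotOutput ω ζ t| ≤ ‖ζ t‖ := by
  simpa [norm_mul, norm_carrier, rotOutput] using Complex.abs_im_le_norm (carrier ω t * ζ t)

namespace SlowDynamics

variable {σ : ℝ → ℝ} {ω T l κ : ℝ} {ζ η : ℝ → ℂ}

theorem integral_satPotential_nonneg (hσ : IsSaturation σ) (hT : 0 ≤ T) (t : ℝ) :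
    0 ≤ ∫ s in (t - T)..t, satPotential σ (rotOutput ω ζ s) := by
  obtain ⟨l, hl, hlip⟩ := hσ.exists_abs_sub_le
  exact intervalIntegral.integral_nonneg (by linarith)
    fun s _ => satPotential_nonneg hσ.odd hσ.mono hl hlip hσ.continuous _

theorem slowEnergy_nonneg (hσ : IsSaturation σ) (hT : 0 ≤ T) (t : ℝ) :
    0 ≤ slowEnergy σ ω T ζ η t := by
  have := integral_satPotential_nonneg (ω := ω) (ζ := ζ) hσ hT t
  rw [slowEnergy]
  positivity

theorem slowEnergy_le_of_norm_le (h : SlowDynamics σ ω ζ η) (hσ : IsSaturation σ) (hl : 0 < l)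
    (hlip : ∀ a b, |σ a - σ b| ≤ l * |a - b|) (hT : 0 ≤ T) {t ρ : ℝ} (hη : ‖η t‖ ≤ ρ)
    (hζ : ∀ s ∈ Set.Icc (t - T) t, ‖ζ s‖ ≤ ρ) :
    slowEnergy σ ω T ζ η t ≤ T * (1 / 2 + l) * ρ ^ 2 := by
  have hS : Continuous fun s => satPotential σ (rotOutput ω ζ s) :=
    (continuous_satPotential hσ.continuous).comp h.continuous_rotOutput
  have h1 := intervalIntegral.integral_mono_on (μ := MeasureTheory.volume)
    (g := fun _ => l * ρ ^ 2) (by linarith : t - T ≤ t)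
    (hS.intervalIntegrable _ _) intervalIntegrable_const (fun s hs => by
      refine (satPotential_le_mul_sq hσ.odd hσ.mono hl hlip hσ.continuous _).trans ?_
      rw [← sq_abs]
      have := (abs_rotOutput_le ω ζ s).trans (hζ s hs)
      gcongr)
  rw [intervalIntegral.integral_const, smul_eq_mul, sub_sub_cancel] at h1
  have h2 : T / 2 * ‖η t‖ ^ 2 ≤ T / 2 * ρ ^ 2 := by gcongr
  rw [slowEnergy]
  linarith

theorem slowEnergy_decay (h : SlowDynamics σ ω ζ η) (hσ : IsSaturation σ)
    (hκ : 0 < κ) (hκ1 : κ ≤ 1) (hhalf : ∀ r, 0 ≤ r → κ * σ r ≤ σ (r / 2)) (hl : 0 < l)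
    (hlip : ∀ a b, |σ a - σ b| ≤ l * |a - b|) (hT : FastRotation κ l ω T) {t : ℝ} (ht : T ≤ t) :
    slowEnergy σ ω T ζ η (t + T) ≤ slowEnergy σ ω T ζ η t
      - κ ^ 2 / 1024 * inputMass σ ω T ζ t ^ 2 - inputChange σ ω T ζ t ^ 2 :=
  h.slowEnergy_add_period_le_of_small hσ hκ hκ1 hhalf hl hlip hT.period hT.pos hT.le_one
    hT.lipschitz_le hT.le_sq hT.damping ht

/-- The input over the next period controls the amplitude of the output. -/
theorem map_norm_fst_le (h : SlowDynamics σ ω ζ η) (hσ : IsSaturation σ)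
    (hκ : 0 < κ) (hκ1 : κ ≤ 1) (hhalf : ∀ r, 0 ≤ r → κ * σ r ≤ σ (r / 2)) (hl : 0 < l)
    (hlip : ∀ a b, |σ a - σ b| ≤ l * |a - b|) (hT : FastRotation κ l ω T) {t : ℝ} (ht : T ≤ t) :
    κ / 8 * (T * σ ‖ζ t‖) ≤ 2 * (inputMass σ ω T ζ t + inputChange σ ω T ζ t) := by
  have h1 := h.mul_le_norm_inputMean hσ hκ.le hhalf hlip hT.period hT.pos ht
  have h2 := norm_inputMean_le (σ := σ) (ω := ω) (ζ := ζ) hT.pos.le t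
  have hA := inputMass_nonneg σ ω hT.pos.le ζ t
  have hD := inputChange_nonneg σ ω hT.pos.le ζ t
  have hTp := hT.pos
  have h3 : T * l * (1 + T) ≤ T * l * 2 := by
    gcongr
    linarith [hT.le_one]
  have h4 : T * l * (1 + T) * (inputMass σ ω T ζ t + inputChange σ ω T ζ t)
      ≤ 1 * (inputMass σ ω T ζ t + inputChange σ ω T ζ t) := by
    gcongr
    linarith [hT.lipschitz_le]
  linarith

theorem slowEnergy_add_mul_le (h : SlowDynamics σ ω ζ η) (hσ : IsSaturation σ)
    (hκ : 0 < κ) (hκ1 : κ ≤ 1) (hhalf : ∀ r, 0 ≤ r → κ * σ r ≤ σ (r / 2)) (hl : 0 < l)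
    (hlip : ∀ a b, |σ a - σ b| ≤ l * |a - b|) (hT : FastRotation κ l ω T) {t : ℝ} (ht : T ≤ t)
    (n : ℕ) : slowEnergy σ ω T ζ η (t + n * T) ≤ slowEnergy σ ω T ζ η t := by
  induction n with
  | zero => simp
  | succ n ih =>
    have hTp := hT.pos
    have h1 := h.slowEnergy_decay hσ hκ hκ1 hhalf hl hlip hT (t := t + n * T)
      (by have : 0 ≤ n * T := by positivity
          linarith)
    have h2 : 0 ≤ κ ^ 2 / 1024 * inputMass σ ω T ζ (t + n * T) ^ 2 := by positivity
    have h3 := sq_nonneg (inputChange σ ω T ζ (t + n * T))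
    have h4 : t + (n + 1 : ℕ) * T = t + n * T + T := by push_cast; ring
    rw [h4]
    linarith

/-- Solutions that start small stay small. -/
theorem exists_stable (hσ : IsSaturation σ)
    (hκ : 0 < κ) (hκ1 : κ ≤ 1) (hhalf : ∀ r, 0 ≤ r → κ * σ r ≤ σ (r / 2)) (hl : 0 < l)
    (hlip : ∀ a b, |σ a - σ b| ≤ l * |a - b|) (hT : FastRotation κ l ω T) {e : ℝ} (he : 0 < e) :
    ∃ ρ : ℝ, 0 < ρ ∧ ∀ ζ η : ℝ → ℂ, SlowDynamics σ ω ζ η →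
      (∀ t ∈ Set.Icc 0 (2 * T), ‖ζ t‖ ≤ ρ ∧ ‖η t‖ ≤ ρ) →
      ∀ t, 0 ≤ t → ‖ζ t‖ < e ∧ ‖η t‖ < e := by
  have hTp := hT.pos
  have hσe := hσ.pos he
  -- Then κ/8 · T σ(e) = 4μ, so A < μ and D < μ exclude ‖ζ t‖ ≥ e by `map_norm_fst_le`. The
  -- threshold b is the energy below which these bounds, and ‖η t‖ < e, are forced.
  set μ := κ * T * σ e / 32 with hμ
  have hμ0 : 0 < μ := by positivity
  set b := min (κ ^ 2 / 1024 * μ ^ 2) (T / 2 * e ^ 2) with hb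
  have hb0 : 0 < b := by positivity
  set c := T * (1 / 2 + l) with hc
  have hc0 : 0 < c := by positivity
  obtain ⟨ρ, hρ0, hρ1, hρe, hρb⟩ : ∃ ρ : ℝ, 0 < ρ ∧ ρ ≤ 1 ∧ ρ < e ∧ c * ρ < b := by
    refine ⟨min 1 (min (e / 2) (b / (2 * c))), by positivity, min_le_left _ _,
      ((min_le_right _ _).trans (min_le_left _ _)).trans_lt (by linarith), ?_⟩
    calc c * min 1 (min (e / 2) (b / (2 * c))) ≤ c * (b / (2 * c)) := by
          gcongr
          exact (min_le_right _ _).trans (min_le_right _ _)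
      _ = b / 2 := by field_simp
      _ < b := by linarith
  refine ⟨ρ, hρ0, fun ζ η h hsmall t ht => ?_⟩
  rcases lt_or_ge t T with htT | htT
  · have h1 := hsmall t ⟨ht, by linarith⟩
    exact ⟨h1.1.trans_lt hρe, h1.2.trans_lt hρe⟩
  have hE : slowEnergy σ ω T ζ η t < b := by
    -- The energy is known to decrease only over whole periods, so t is brought back by whole
    -- periods into [T, 2T), where the state and its last period are small by assumption.
    set n := ⌊(t - T) / T⌋₊
    have hn1 : n * T ≤ t - T :=
      (le_div_iff₀ hTp).1 (Nat.floor_le (div_nonneg (by linarith) hTp.le))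
    have hn2 : t - T < (n + 1) * T := (div_lt_iff₀ hTp).1 (Nat.lt_floor_add_one _)
    have h1 := h.slowEnergy_add_mul_le hσ hκ hκ1 hhalf hl hlip hT (t := t - n * T)
      (by linarith) n
    rw [sub_add_cancel] at h1
    have h2 := h.slowEnergy_le_of_norm_le hσ hl hlip hTp.le (t := t - n * T) (ρ := ρ)
      (hsmall _ ⟨by linarith, by linarith⟩).2
      fun s hs => (hsmall s ⟨by linarith [hs.1], by linarith [hs.2]⟩).1
    calc slowEnergy σ ω T ζ η t ≤ c * ρ ^ 2 := h1.trans h2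
      _ ≤ c * ρ := by
        gcongr
        nlinarith
      _ < b := hρb
  -- As the energy stays nonnegative, its loss over the next period is below b, which bounds A and
  -- D.
  have hdecay := h.slowEnergy_decay hσ hκ hκ1 hhalf hl hlip hT htT
  have hnn := slowEnergy_nonneg (ω := ω) (ζ := ζ) (η := η) hσ hTp.le (t + T)
  have hA := inputMass_nonneg σ ω hTp.le ζ t
  have hD := inputChange_nonneg σ ω hTp.le ζ t
  have hA2 : 0 ≤ κ ^ 2 / 1024 * inputMass σ ω T ζ t ^ 2 := by positivity
  have hD2 := sq_nonneg (inputChange σ ω T ζ t)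
  have hb1 : b ≤ κ ^ 2 / 1024 * μ ^ 2 := min_le_left _ _
  have hb2 : b ≤ T / 2 * e ^ 2 := min_le_right _ _
  constructor
  · have hA' : inputMass σ ω T ζ t < μ := by
      refine lt_of_pow_lt_pow_left₀ 2 hμ0.le ?_
      refine lt_of_mul_lt_mul_left (a := κ ^ 2 / 1024) ?_ (by positivity)
      linarith
    have hD' : inputChange σ ω T ζ t < μ := by
      refine lt_of_pow_lt_pow_left₀ 2 hμ0.le ?_
      have h1 : κ ^ 2 / 1024 * μ ^ 2 ≤ 1 * μ ^ 2 := by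
        gcongr
        nlinarith
      linarith
    have h1 := h.map_norm_fst_le hσ hκ hκ1 hhalf hl hlip hT htT
    by_contra! hcon
    have h2 : κ / 8 * (T * σ e) ≤ κ / 8 * (T * σ ‖ζ t‖) := by
      gcongr
      exact hσ.mono hcon
    linarith
  · refine lt_of_pow_lt_pow_left₀ 2 he.le ?_
    refine lt_of_mul_lt_mul_left (a := T / 2) ?_ (by positivity)
    have h1 := integral_satPotential_nonneg (ω := ω) (ζ := ζ) hσ hTp.le t
    rw [slowEnergy] at hE
    linarith

theorem _root_.tendsto_zero_of_sq_le {f g : ℕ → ℝ} (hf : ∀ n, 0 ≤ f n) (hfg : ∀ n, f n ^ 2 ≤ g n)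
    (hg : Tendsto g atTop (𝓝 0)) : Tendsto f atTop (𝓝 0) := by
  have h1 : Tendsto (fun n => f n ^ 2) atTop (𝓝 0) :=
    squeeze_zero (fun n => sq_nonneg _) hfg hg
  have h2 := (Real.continuous_sqrt.tendsto 0).comp h1
  rw [Real.sqrt_zero] at h2
  refine h2.congr fun n => ?_
  simp [Real.sqrt_sq (hf n)]

/-- The state converges to the origin along a sequence of times. -/
theorem tendsto_zero_along_periods (h : SlowDynamics σ ω ζ η) (hσ : IsSaturation σ)
    (hκ : 0 < κ) (hκ1 : κ ≤ 1) (hhalf : ∀ r, 0 ≤ r → κ * σ r ≤ σ (r / 2)) (hl : 0 < l)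
    (hlip : ∀ a b, |σ a - σ b| ≤ l * |a - b|) (hT : FastRotation κ l ω T) :
    Tendsto (fun n : ℕ => ‖ζ ((n + 1) * T)‖) atTop (𝓝 0) ∧
      Tendsto (fun n : ℕ => ‖η ((n + 1) * T)‖) atTop (𝓝 0) := by
  have hTp := hT.pos
  set τ : ℕ → ℝ := fun n => (n + 1) * T with hτdef
  have hτ : ∀ n, T ≤ τ n := fun n => by
    have : 0 ≤ n * T := by positivity
    simp only [τ]
    linarith
  have hτs : ∀ n, τ (n + 1) = τ n + T := fun n => by simp only [τ]; push_cast; ring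
  have hA := fun n => inputMass_nonneg σ ω hTp.le ζ (τ n)
  have hD := fun n => inputChange_nonneg σ ω hTp.le ζ (τ n)
  have hdecay := fun n => h.slowEnergy_decay hσ hκ hκ1 hhalf hl hlip hT (hτ n)
  simp only [← hτs] at hdecay
  have hanti : Antitone fun n => slowEnergy σ ω T ζ η (τ n) := by
    refine antitone_nat_of_succ_le fun n => ?_
    have h1 : 0 ≤ κ ^ 2 / 1024 * inputMass σ ω T ζ (τ n) ^ 2 := by positivity
    linarith [hdecay n, sq_nonneg (inputChange σ ω T ζ (τ n))]
  have hbdd : BddBelow (Set.range fun n => slowEnergy σ ω T ζ η (τ n)) :=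
    ⟨0, by rintro _ ⟨n, rfl⟩; exact slowEnergy_nonneg hσ hTp.le _⟩
  have hlim := tendsto_atTop_ciInf hanti hbdd
  -- A bounded monotone sequence has vanishing increments, and these dominate A² and D².
  have hdiff := hlim.sub (hlim.comp (tendsto_add_atTop_nat 1))
  rw [sub_self] at hdiff
  simp only [Function.comp_def] at hdiff
  have hDlim : Tendsto (fun n => inputChange σ ω T ζ (τ n)) atTop (𝓝 0) := by
    refine tendsto_zero_of_sq_le hD (fun n => ?_) hdiff
    have h1 : 0 ≤ κ ^ 2 / 1024 * inputMass σ ω T ζ (τ n) ^ 2 := by positivity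
    linarith [hdecay n]
  have hAlim : Tendsto (fun n => inputMass σ ω T ζ (τ n)) atTop (𝓝 0) := by
    have h1 := hdiff.const_mul (1024 / κ ^ 2)
    rw [mul_zero] at h1
    refine tendsto_zero_of_sq_le hA (fun n => ?_) h1
    have h2 : κ ^ 2 / 1024 * inputMass σ ω T ζ (τ n) ^ 2
        ≤ slowEnergy σ ω T ζ η (τ n) - slowEnergy σ ω T ζ η (τ (n + 1)) := by
      linarith [hdecay n, sq_nonneg (inputChange σ ω T ζ (τ n))]
    calc inputMass σ ω T ζ (τ n) ^ 2
        = 1024 / κ ^ 2 * (κ ^ 2 / 1024 * inputMass σ ω T ζ (τ n) ^ 2) := by field_simp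
      _ ≤ _ := by gcongr
  have hζ : Tendsto (fun n => ‖ζ (τ n)‖) atTop (𝓝 0) := by
    rw [Metric.tendsto_atTop']
    intro e he
    have h1 := (hAlim.add hDlim).const_mul 2
    rw [add_zero, mul_zero] at h1
    have hσe := hσ.pos he
    obtain ⟨N, hN⟩ := eventually_atTop.1
      (h1.eventually (gt_mem_nhds (show 0 < κ / 8 * (T * σ e) by positivity)))
    refine ⟨N, fun n hn => ?_⟩
    rw [Real.dist_eq, sub_zero, abs_norm]
    by_contra! hcon
    have h2 := h.map_norm_fst_le hσ hκ hκ1 hhalf hl hlip hT (hτ n)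
    have h3 : κ / 8 * (T * σ e) ≤ κ / 8 * (T * σ ‖ζ (τ n)‖) := by
      gcongr
      exact hσ.mono hcon
    linarith [hN n hn.le]
  refine ⟨hζ, ?_⟩
  -- Over a period ζ moves by T η up to the input mass; both ends tend to 0, hence so does η.
  have hbound : ∀ n, ‖η (τ n)‖ ≤ T⁻¹ * (‖ζ (τ (n + 1))‖ + ‖ζ (τ n)‖
      + (inputMass σ ω T ζ (τ n) * T + inputMass σ ω T ζ (τ n))) := by
    intro n
    have h0 : 0 ≤ τ n := hTp.le.trans (hτ n)
    have h1 := h.norm_fst_sub_le hσ.continuous h0 (by linarith : τ n ≤ τ n + T) (η (τ n))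
      (M := inputMass σ ω T ζ (τ n)) fun s hs =>
        (h.norm_snd_sub_le hσ.continuous h0 hs.1).trans
          (h.integral_abs_rotInput_mono hσ.continuous le_rfl hs.1 hs.2)
    rw [add_sub_cancel_left, ← hτs, hτs n, ← inputMass, ← hτs] at h1
    have h2 : ‖(T : ℂ) * η (τ n)‖ = T * ‖η (τ n)‖ := by
      rw [norm_mul, Complex.norm_real, Real.norm_of_nonneg hTp.le]
    have h3 : (T : ℂ) * η (τ n)
        = ζ (τ (n + 1)) - ζ (τ n) - (ζ (τ (n + 1)) - ζ (τ n) - T * η (τ n)) := by ring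
    have h4 : T * ‖η (τ n)‖ ≤ ‖ζ (τ (n + 1))‖ + ‖ζ (τ n)‖
        + (inputMass σ ω T ζ (τ n) * T + inputMass σ ω T ζ (τ n)) := by
      rw [← h2, h3]
      exact (norm_sub_le _ _).trans (add_le_add (norm_sub_le _ _) h1)
    rw [← div_eq_inv_mul, le_div_iff₀ hTp]
    linarith
  refine squeeze_zero (fun n => norm_nonneg _) hbound ?_
  have h1 := (((hζ.comp (tendsto_add_atTop_nat 1)).add hζ).add
    ((hAlim.mul_const T).add hAlim)).const_mul T⁻¹
  simpa using h1

end SlowDynamics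

/-! ### The closed-loop system -/

/-- The Euclidean plane as the complex line. -/
noncomputable def planeToComplex : Plane ≃ₗᵢ[ℝ] ℂ := Complex.orthonormalBasisOneI.repr.symm

theorem planeToComplex_apply (v : Plane) : planeToComplex v = v 0 + v 1 * Complex.I :=
  Complex.orthonormalBasisOneI_repr_symm_apply v

theorem planeToComplex_A₀ (v : Plane) :
    planeToComplex (Matrix.toEuclideanLin A₀ v) = Complex.I * planeToComplex v := by
  rw [planeToComplex_apply, planeToComplex_apply]
  apply Complex.ext <;>
    simp [A₀, Matrix.toLpLin_apply, dotProduct, Fin.sum_univ_two]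

theorem planeToComplex_e₂ : planeToComplex e₂ = Complex.I := by
  rw [planeToComplex_apply]
  simp [e₂]

theorem inner_e₂ (v : Plane) : inner ℝ e₂ v = (planeToComplex v).im := by
  rw [planeToComplex_apply]
  simp [e₂, EuclideanSpace.inner_single_left]

theorem rescaledClosedLoop_zero {σ : ℝ → ℝ} (h0 : σ 0 = 0) (ε : ℝ) (K : Plane × Plane) :
    rescaledClosedLoop σ ε K 0 = 0 := by
  simp [rescaledClosedLoop, h0]

theorem exists_lipschitzWith_rescaledClosedLoop {σ : ℝ → ℝ} {L : NNReal} (hσ : LipschitzWith L σ)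
    (ε : ℝ) (K : Plane × Plane) : ∃ C : NNReal, LipschitzWith C (rescaledClosedLoop σ ε K) := by
  let A : Plane →L[ℝ] Plane := (2 * Real.pi / ε) • (Matrix.toEuclideanLin A₀).toContinuousLinearMap
  let f : Plane × Plane →L[ℝ] Plane :=
    A ∘L ContinuousLinearMap.fst ℝ Plane Plane + ContinuousLinearMap.snd ℝ Plane Plane
  let g : Plane × Plane →L[ℝ] Plane := A ∘L ContinuousLinearMap.snd ℝ Plane Plane
  let k : Plane × Plane →L[ℝ] ℝ := innerSL ℝ K.1 ∘L ContinuousLinearMap.fst ℝ Plane Plane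
    + innerSL ℝ K.2 ∘L ContinuousLinearMap.snd ℝ Plane Plane
  let b : ℝ →L[ℝ] Plane := ContinuousLinearMap.toSpanSingleton ℝ e₂
  exact ⟨_, f.lipschitz.prodMk (g.lipschitz.sub (b.lipschitz.comp (hσ.comp k.lipschitz)))⟩

/-! ### Passage of trajectories to the rotating frame -/

theorem hasDerivAt_conj_carrier (ω t : ℝ) :
    HasDerivAt (fun s => conj (carrier ω s)) (-(ω * Complex.I * conj (carrier ω t))) t := by
  have h : ∀ s : ℝ, conj (carrier ω s) = Complex.exp (-(ω * Complex.I) * s) := fun s => by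
    rw [carrier, ← Complex.exp_conj]
    congr 1
    simp
    ring
  simp only [h]
  have h1 : HasDerivAt (fun s : ℝ => -(ω * Complex.I) * (s : ℂ)) (-(ω * Complex.I)) t := by
    simpa using (Complex.ofRealCLM.hasDerivAt (x := t)).const_mul (-(ω * Complex.I) : ℂ)
  convert h1.cexp using 1
  ring

theorem HasDerivAt.rotate {ω t : ℝ} {f : ℝ → ℂ} {g : ℂ}
    (hf : HasDerivAt f (ω * Complex.I * f t + g) t) :
    HasDerivAt (fun s => conj (carrier ω s) * f s) (conj (carrier ω t) * g) t := by
  exact ((hasDerivAt_conj_carrier ω t).mul hf).congr_deriv (by ring)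

/-- A trajectory of the closed-loop system, in the rotating frame. -/
theorem IsTrajectory.slowDynamics {σ : ℝ → ℝ} {ε : ℝ} {x : ℝ → Plane × Plane}
    (hx : IsTrajectory (rescaledClosedLoop σ ε (e₂, e₂)) x) :
    SlowDynamics σ (2 * Real.pi / ε)
      (fun t => conj (carrier (2 * Real.pi / ε) t)
        * planeToComplex ((x (max t 0)).1 + (x (max t 0)).2))
      (fun t => conj (carrier (2 * Real.pi / ε) t) * planeToComplex (x (max t 0)).2) := by
  set ω := 2 * Real.pi / ε with hω
  have hcar : Continuous fun t => conj (carrier ω t) :=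
    Complex.continuous_conj.comp (continuous_carrier ω)
  -- Replacing t by max t 0 extends the trajectory by a constant to negative times: continuity is
  -- then global, and the equations are only needed for t > 0.
  have hxc : Continuous fun t => x (max t 0) :=
    (IsIntegralCurveOn.continuousOn hx).comp_continuous (by fun_prop) fun t => le_max_right t 0
  have hder : ∀ t, 0 < t → HasDerivAt (fun s => x (max s 0))
      (rescaledClosedLoop σ ε (e₂, e₂) (x (max t 0))) t := by
    intro t ht
    have h1 := (hx t ht.le).hasDerivAt (Ici_mem_nhds ht)
    rw [max_eq_left ht.le]
    refine h1.congr_of_eventuallyEq ?_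
    filter_upwards [lt_mem_nhds ht] with s hs
    rw [max_eq_left hs.le]
  have hp : ∀ (f : ℝ → Plane) (f' : Plane) (t : ℝ), HasDerivAt f f' t →
      HasDerivAt (fun s => planeToComplex (f s)) (planeToComplex f') t := fun f f' t hf =>
    planeToComplex.toContinuousLinearEquiv.toContinuousLinearMap.hasFDerivAt.comp_hasDerivAt t hf
  set ζ : ℝ → ℂ := fun t => conj (carrier ω t)
        * planeToComplex ((x (max t 0)).1 + (x (max t 0)).2) with hζ
  have hout : ∀ t, inner ℝ e₂ (x (max t 0)).1 + inner ℝ e₂ (x (max t 0)).2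
      = rotOutput ω ζ t := by
    intro t
    rw [rotOutput, hζ]
    simp only
    rw [← mul_assoc, carrier_mul_conj, one_mul, map_add, Complex.add_im, inner_e₂, inner_e₂]
  have hcomp : ∀ t : ℝ, planeToComplex (rescaledClosedLoop σ ε (e₂, e₂) (x (max t 0))).1
        = ω * Complex.I * planeToComplex (x (max t 0)).1 + planeToComplex (x (max t 0)).2 ∧
      planeToComplex (rescaledClosedLoop σ ε (e₂, e₂) (x (max t 0))).2
        = ω * Complex.I * planeToComplex (x (max t 0)).2
          + -(Complex.I * rotInput σ ω ζ t) := by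
    intro t
    have h1 := hout t
    simp only [rescaledClosedLoop, h1, ← hω, map_add, map_sub, map_smul, planeToComplex_A₀,
      planeToComplex_e₂, Complex.real_smul, rotInput]
    exact ⟨by ring, by ring⟩
  refine ⟨?_, ?_, fun t ht => ?_, fun t ht => ?_⟩
  · exact hcar.mul (planeToComplex.continuous.comp (hxc.fst.add hxc.snd))
  · exact hcar.mul (planeToComplex.continuous.comp hxc.snd)
  · have h1 := hp _ _ t (hder t ht).fst
    have h2 := hp _ _ t (hder t ht).snd
    rw [(hcomp t).1] at h1
    rw [(hcomp t).2] at h2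
    have h3 : HasDerivAt (fun s => planeToComplex ((x (max s 0)).1 + (x (max s 0)).2))
        (ω * Complex.I * planeToComplex ((x (max t 0)).1 + (x (max t 0)).2)
          + (planeToComplex (x (max t 0)).2 - Complex.I * rotInput σ ω ζ t)) t := by
      simp only [map_add]
      exact (h1.add h2).congr_deriv (by ring)
    convert h3.rotate using 1
    rw [demodInput]
    ring
  · have h2 := hp _ _ t (hder t ht).snd
    rw [(hcomp t).2] at h2
    convert h2.rotate using 1
    rw [demodInput]
    ring

theorem norm_conj_carrier_mul (ω t : ℝ) (z : ℂ) : ‖conj (carrier ω t) * z‖ = ‖z‖ := by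
  rw [norm_mul, RCLike.norm_conj, norm_carrier, one_mul]

theorem norm_le_of_norm_add_lt {v : Plane × Plane} {e : ℝ} (h1 : ‖v.1 + v.2‖ < e)
    (h2 : ‖v.2‖ < e) : ‖v‖ < 2 * e := by
  have h3 : ‖v.1‖ ≤ ‖v.1 + v.2‖ + ‖v.2‖ := by
    simpa using norm_sub_le (v.1 + v.2) v.2
  have h4 := norm_nonneg v.2
  exact max_lt (by linarith) (by linarith)

theorem isGAS_rescaledClosedLoop {σ : ℝ → ℝ} (hσ : IsSaturation σ) {κ l ε : ℝ}
    (hκ : 0 < κ) (hκ1 : κ ≤ 1) (hhalf : ∀ r, 0 ≤ r → κ * σ r ≤ σ (r / 2)) (hl : 0 < l)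
    (hlip : ∀ a b, |σ a - σ b| ≤ l * |a - b|) (hε : FastRotation κ l (2 * Real.pi / ε) ε) :
    IsGAS (rescaledClosedLoop σ ε (e₂, e₂)) := by
  obtain ⟨L, hL⟩ := hσ.lipschitz
  obtain ⟨C, hF⟩ := exists_lipschitzWith_rescaledClosedLoop hL ε (e₂, e₂)
  have hF0 := rescaledClosedLoop_zero hσ.map_zero ε (e₂, e₂)
  have hstable : ∀ η : ℝ, 0 < η → ∃ δ : ℝ, 0 < δ ∧ ∀ x : ℝ → Plane × Plane,
      IsTrajectory (rescaledClosedLoop σ ε (e₂, e₂)) x → ‖x 0‖ < δ →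
      ∀ t : ℝ, 0 ≤ t → ‖x t‖ < η := by
    intro η hη
    -- Half of the target, because the bounds control x₁ + x₂ and x₂, and x₁ is their difference.
    -- The factor exp(2Cε) below is the growth over the first two periods.
    obtain ⟨ρ, hρ, hst⟩ := SlowDynamics.exists_stable hσ hκ hκ1 hhalf hl hlip hε (half_pos hη)
    have hexp := Real.exp_pos (C * (2 * ε))
    refine ⟨ρ / (2 * Real.exp (C * (2 * ε))), by positivity, fun x hx hx0 t ht => ?_⟩
    have hbound : ∀ s ∈ Set.Icc 0 (2 * ε), ‖x s‖ ≤ ρ / 2 := by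
      intro s hs
      calc ‖x s‖ ≤ ‖x 0‖ * Real.exp (C * s) := hx.norm_le_of_lipschitz hF hF0 hs.1
        _ ≤ ρ / (2 * Real.exp (C * (2 * ε))) * Real.exp (C * (2 * ε)) := by
          gcongr
          exact hs.2
        _ = ρ / 2 := by field_simp
    have h1 := hst _ _ hx.slowDynamics (fun s hs => by
      have h2 := hbound s hs
      have h3 := norm_fst_le (x s)
      have h4 := norm_snd_le (x s)
      have h5 := norm_add_le (x s).1 (x s).2
      rw [norm_conj_carrier_mul, norm_conj_carrier_mul, LinearIsometryEquiv.norm_map,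
        LinearIsometryEquiv.norm_map, max_eq_left hs.1]
      constructor <;> linarith) t ht
    rw [norm_conj_carrier_mul, norm_conj_carrier_mul, LinearIsometryEquiv.norm_map,
      LinearIsometryEquiv.norm_map, max_eq_left ht] at h1
    linarith [norm_le_of_norm_add_lt h1.1 h1.2]
  refine ⟨exists_isTrajectory_of_lipschitz hF, fun x x' hx hx' h0 t ht =>
    hx.eq_of_lipschitz hF hx' h0 ht, hstable, fun x hx => ?_⟩
  rw [Metric.tendsto_atTop]
  intro η hη
  -- Once the state enters the δ-ball at some multiple of ε, stability applied to the time-shifted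
  -- trajectory confines it from then on.
  obtain ⟨δ, hδ, hst⟩ := hstable η hη
  obtain ⟨h1, h2⟩ :=
    hx.slowDynamics.tendsto_zero_along_periods hσ hκ hκ1 hhalf hl hlip hε
  obtain ⟨n, hn1, hn2⟩ := ((h1.eventually (gt_mem_nhds (half_pos hδ))).and
    (h2.eventually (gt_mem_nhds (half_pos hδ)))).exists
  have hτ : 0 ≤ (n + 1) * ε := by
    have := hε.pos
    positivity
  rw [norm_conj_carrier_mul, LinearIsometryEquiv.norm_map, max_eq_left hτ] at hn1 hn2
  have hxn := norm_le_of_norm_add_lt hn1 hn2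
  refine ⟨(n + 1) * ε, fun t ht => ?_⟩
  have h3 := hst _ (hx.comp_add hτ) (by rw [zero_add]; linarith) (t - (n + 1) * ε)
    (sub_nonneg.2 ht)
  rwa [sub_add_cancel, ← dist_zero_right] at h3

theorem mainTheorem2 (σ : ℝ → ℝ) (hσ : IsSaturation σ) :
    ∃ ε₀ : ℝ, 0 < ε₀ ∧ ∀ ε : ℝ, 0 < ε → ε < ε₀ →
      IsGAS (rescaledClosedLoop σ ε (e₂, e₂)) := by
  obtain ⟨l, hl, hlip⟩ := hσ.exists_abs_sub_le
  obtain ⟨κ, hκ, hκ1, hhalf⟩ := hσ.exists_mul_le_half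
  -- Each entry of the minimum yields one smallness condition of `FastRotation` with T = ε.
  refine ⟨min (min 1 (κ / (64 * l))) (min (κ ^ 2 / 2048) (1 / (2 * l * (10 + 2048 / κ ^ 2)))),
    by positivity, fun ε hε hlt => ?_⟩
  simp only [lt_min_iff] at hlt
  obtain ⟨⟨h1, h2⟩, h3, h4⟩ := hlt
  rw [lt_div_iff₀ (by positivity)] at h2 h3 h4
  exact isGAS_rescaledClosedLoop hσ hκ hκ1 hhalf hl hlip
    ⟨div_mul_cancel₀ _ hε.ne', hε, h1.le, by linarith, by linarith, by linarith⟩
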